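/- Let $\mathcal A=\bigoplus_{j\ge 0}A_j$ be a commutative graded $\mathbb Z$-algebra with identity such that each $A_j$ is a free abelian group of finite rank. Graphs are finite and may have loops and multiple edges. For a graph $G$ with a chosen linear ordering of its edges, let $H^i_{\mathcal A}(G)$ be the $i$-th cohomology group of the cochain complex with $C^i(G)=\bigoplus_{s\subseteq E(G),\,|s|=i}\mathcal A^{\otimes k(s)}$, where the tensor factors (over $\mathbb Z$) are indexed by the $k(s)$ connected components of the spanning subgraph $[G:s]$ with vertex set $V(G)$ and edge set $s$. The differential is the sum over $s$ and $e\in E(G)\setminus s$ of the maps $(-1)^{\#\{f\in s\,:\,f<e\}}d_{s,e}$, where $d_{s,e}:\mathcal A^{\otimes k(s)}\to\mathcal A^{\otimes k(s\cup\{e\})}$ multiplies together the two tensor factors of the components joined by $e$ if $e$ joins two different components of $[G:s]$, and is the identity otherwise. The grading of $\mathcal A$ induces gradings $H^i_{\mathcal A}(G)=\bigoplus_{j\ge0}H^{i,j}_{\mathcal A}(G)$. Let $P_n$ be the polygon with $n$ vertices and $n$ edges ($P_2$ consists of two vertices joined by two edges). A graph is called $P_n$-series-parallel if it can be obtained from $P_n$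 by finitely many operations, each of which either replaces an edge by two parallel edges or subdivides an edge. Let $n\ge 2$ and let $G$ be a $P_n$-series-parallel graph with $v$ vertices. Then there is a degree-preserving epimorphism $$H^{n-2}_{\mathcal A}(P_n)\twoheadrightarrow H^{v-2}_{\mathcal A}(G).$$ If $n\ge 3$, then moreover there is a degree-preserving isomorphism $H^1_{\mathcal A}(P_3)\cong H^{n-2}_{\mathcal A}(P_n)$, and hence a degree-preserving epimorphism $H^1_{\mathcal A}(P_3)\twoheadrightarrow H^{v-2}_{\mathcal A}(G)$. -/

import Mathlib

/-!
# Cohomology of finite multigraphs with coefficients in a commutative graded algebra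

Multigraphs (parallel edges and loops are allowed) are Mathlib's `Graph α β`.
-/

namespace GraphCohomology

open scoped TensorProduct

section Graphs

/-- The polygon with `n` vertices and `n` edges: edge `i` joins `i` to its cyclic successor.
`polygon 1` is one vertex with a loop, `polygon 2` is two vertices joined by two edges. -/
def polygon (n : ℕ) : Graph (Fin n) (Fin n) where
  vertexSet := Set.univ
  IsLink i x y := s(x, y) = s(i, finRotate n i)
  isLink_symm _ _ := ⟨fun x y h => by rw [Sym2.eq_swap]; exact h⟩
  eq_or_eq_of_isLink_of_isLink := by
    intro e x y v w h h'
    have h2 : s(x, y) = s(v, w) := h.trans h'.symm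
    rcases Sym2.eq_iff.1 h2 with h3 | h3
    · exact Or.inl h3.1
    · exact Or.inr h3.1
  left_mem_of_isLink _ _ _ _ := Set.mem_univ _

variable {α β : Type*}

/-- `G` and `K` are isomorphic multigraphs. -/
def IsIsomorphic {α' β' : Type*} (G : Graph α β) (K : Graph α' β') : Prop :=
  ∃ (φ : G.vertexSet ≃ K.vertexSet) (ψ : G.edgeSet ≃ K.edgeSet),
    ∀ (e : G.edgeSet) (x y : G.vertexSet),
      G.IsLink e x y ↔ K.IsLink (ψ e) (φ x) (φ y)

/-- `K` arises from `G` by replacing an edge `e` by two parallel edges `e`, `f`. -/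
def IsDoubling (G K : Graph α β) : Prop :=
  ∃ e ∈ G.edgeSet, ∃ f ∉ G.edgeSet,
    K.vertexSet = G.vertexSet ∧
    ∀ g u v, K.IsLink g u v ↔ G.IsLink g u v ∨ (g = f ∧ G.IsLink e u v)

/-- `K` arises from `G` by subdividing an edge `e` with ends `x`, `y`: a new vertex `w` is added
and `e` is replaced by an edge (again called `e`) joining `x` to `w` and a new edge `f`
joining `w` to `y`. -/
def IsSubdivision (G K : Graph α β) : Prop :=
  ∃ e x y, G.IsLink e x y ∧ ∃ f ∉ G.edgeSet, ∃ w ∉ G.vertexSet,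
    K.vertexSet = insert w G.vertexSet ∧
    ∀ g u v, K.IsLink g u v ↔
      (g ≠ e ∧ G.IsLink g u v) ∨ (g = e ∧ s(u, v) = s(x, w)) ∨ (g = f ∧ s(u, v) = s(w, y))

/-- `P_n`-series-parallel graphs: those obtained from the polygon `P_n` by finitely many
operations, each replacing an edge by two parallel edges or subdividing an edge. -/
inductive IsSeriesParallel (n : ℕ) : Graph α β → Prop
  | polygon (G : Graph α β) : IsIsomorphic (polygon n) G → IsSeriesParallel n G
  | doubling (G K : Graph α β) : IsSeriesParallel n G → IsDoubling G K → IsSeriesParallel n K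
  | subdivision (G K : Graph α β) :
      IsSeriesParallel n G → IsSubdivision G K → IsSeriesParallel n K

/-- The connected components of the spanning subgraph `[G : s]` with edge set `s`: vertices modulo
the equivalence relation generated by being joined by an edge of `s`. -/
def Comp (G : Graph α β) (s : Finset G.edgeSet) : Type _ :=
  Quot fun x y : G.vertexSet => ∃ e ∈ s, G.IsLink e x y

instance (G : Graph α β) [Finite G.vertexSet] (s : Finset G.edgeSet) : Finite (Comp G s) :=
  inferInstanceAs (Finite (Quot _))

/-- For `s ⊆ t`, each component of `[G : s]` lies in a component of `[G : t]`. -/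
def Comp.incl (G : Graph α β) {s t : Finset G.edgeSet} (h : s ⊆ t) : Comp G s → Comp G t :=
  Quot.map id fun _ _ ⟨e, he, hl⟩ => ⟨e, h he, hl⟩

end Graphs

noncomputable section

variable (R : Type*) [CommRing R] (A : Type*) [CommRing A] [Algebra R A]

section Tensor

open Classical in
/-- The linear map `⨂_ι A → ⨂_κ A` induced by a map `q : ι → κ` of finite index sets, which
multiplies together the tensor factors with the same image under `q`;
see `mergeMap_tprod` for the formula. -/
def mergeMap {ι κ : Type*} [Finite ι] (q : ι → κ) :
    (⨂[R] _ : ι, A) →ₗ[R] (⨂[R] _ : κ, A) :=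
  letI := Fintype.ofFinite ι
  PiTensorProduct.lift
    ((MultilinearMap.mkPiAlgebra R ι (⨂[R] _ : κ, A)).compLinearMap fun i =>
      (PiTensorProduct.singleAlgHom (R := R) (A := fun _ : κ => A) (q i)).toLinearMap)

open Classical in
theorem mergeMap_tprod {ι κ : Type*} [Fintype ι] (q : ι → κ) (a : ι → A) :
    mergeMap R A q (PiTensorProduct.tprod R a) =
      PiTensorProduct.tprod R fun k => ∏ i with q i = k, a i := by
  have h : ∀ (x : ι → A), (∏ i, PiTensorProduct.tprod R (Pi.mulSingle (M := fun _ : κ => A) (q i) (x i))) =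
      PiTensorProduct.tprod R fun k => ∏ i with q i = k, x i := by
    intro x
    rw [← PiTensorProduct.tprod_prod]
    congr 1
    funext k
    rw [Finset.prod_apply, Finset.prod_filter]
    refine Finset.prod_congr rfl fun i _ => ?_
    by_cases hk : q i = k
    · subst hk; simp
    · simp [hk]
  rw [← h a]
  simp only [mergeMap, PiTensorProduct.lift.tprod, MultilinearMap.compLinearMap_apply,
    MultilinearMap.mkPiAlgebra_apply]
  exact Finset.prod_congr (by ext; simp) fun i _ => rfl

variable {R A} in
/-- The homogeneous part of degree `j` of `⨂_ι A`, for a family `𝒜` of homogeneous parts of `A`. -/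
def tensorDegree (𝒜 : ℕ → Submodule R A) (ι : Type*) [Finite ι] (j : ℕ) :
    Submodule R (⨂[R] _ : ι, A) :=
  letI := Fintype.ofFinite ι
  Submodule.span R {z | ∃ (k : ι → ℕ) (a : ι → A),
    (∀ i, a i ∈ 𝒜 (k i)) ∧ ∑ i, k i = j ∧ z = PiTensorProduct.tprod R a}

end Tensor

section Complex

variable {α β : Type*} (G : Graph α β)

/-- The cochain group `C^i(G)`: the direct sum, over the sets `s` of `i` edges, of the tensor
products of copies of `A` indexed by the components of `[G : s]`. (Edge sets are finite here.) -/
abbrev Cochain (i : ℕ) : Type _ :=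
  (s : {s : Finset G.edgeSet // s.card = i}) → ⨂[R] _ : Comp G s.1, A

variable [LinearOrder β] [Finite G.vertexSet]

/-- The differential `d^i : C^i(G) → C^{i+1}(G)`: the component at `t` is the signed sum over
`e ∈ t` of the per-edge maps from `t \ {e}` to `t`, the sign being given by the parity of the
number of edges of `t` before `e`. -/
def differential (i : ℕ) : Cochain R A G i →ₗ[R] Cochain R A G (i + 1) :=
  LinearMap.pi fun t => ∑ e : t.1,
    (-1 : R) ^ (t.1.filter (· < e.1)).card •
      (mergeMap R A (Comp.incl G (t.1.erase_subset e.1)) ∘ₗ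
        LinearMap.proj (⟨t.1.erase e.1, by
          rw [Finset.card_erase_of_mem e.2, t.2, Nat.add_sub_cancel]⟩ :
            {s : Finset G.edgeSet // s.card = i}))

/-- The coboundaries in `C^i(G)`, i.e. the image of `d^{i-1}` (with `C^{-1} = 0`). -/
def coboundaries : (i : ℕ) → Submodule R (Cochain R A G i)
  | 0 => ⊥
  | i + 1 => LinearMap.range (differential R A G i)

/-- The cohomology group `H^i_A(G) = ker d^i / im d^{i-1}`. -/
abbrev Cohomology (i : ℕ) : Type _ :=
  LinearMap.ker (differential R A G i) ⧸
    (coboundaries R A G i).submoduleOf (LinearMap.ker (differential R A G i))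

variable {R A}

/-- The homogeneous part `C^{i,j}(G)` of degree `j` of `C^i(G)`. -/
def cochainDegree (𝒜 : ℕ → Submodule R A) (i j : ℕ) : Submodule R (Cochain R A G i) :=
  Submodule.pi Set.univ fun s => tensorDegree 𝒜 (Comp G s.1) j

/-- The homogeneous part `H^{i,j}_A(G)` of degree `j` of `H^i_A(G)`: the classes of cocycles that
are homogeneous of degree `j`. -/
def cohomologyDegree (𝒜 : ℕ → Submodule R A) (i j : ℕ) : Submodule R (Cohomology R A G i) :=
  Submodule.map (Submodule.mkQ _)
    ((cochainDegree G 𝒜 i j).submoduleOf (LinearMap.ker (differential R A G i)))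

end Complex

end

end GraphCohomology

/-! Everything rests on deletion and contraction of an edge `f` of a graph `K`: the cochains on edge
sets containing `f` form a subcomplex, with quotient the complex of `K - f`.

Suppose `f` is a new parallel copy of an edge `e` of `G`. On sets containing `f` the edge `e` joins
vertices that are already connected, so adding `e` is an isomorphism there and the subcomplex is
acyclic. Hence `K` and `G` have the same cohomology (`IsDoubling.hasGradedIso`).

Suppose instead that `K` subdivides the edge `e` of `G`, with new vertex `w` and new edge `f`.
Contracting `f` gives back `G`, so the subcomplex is the complex of `G` shifted by one, and there is
an exact sequence H^i(K-f) → H^i(G) → H^{i+1}(K) → H^{i+1}(K-f)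
(`SubdivisionData.exists_cohomology_map_of_exactAt`). In `K - f` the remaining half of `e` is
pendant at `w`, and vanishing of cohomology in a given degree survives adding a pendant edge
(`graphDiagram_exactAt_of_pendant`). Without it, `w` is isolated: there are v + 1 vertices, where v
counts those of `G`, and at least two components, so the rank is at most v - 1. A nonempty edge set
has no cohomology in degrees at least its rank (`graphDiagram_exactAt_of_rank`). So for i = v - 2
the last term vanishes and the middle map is onto; induction over the operations gives the
epimorphism.

For polygons `K - f` is a path, whose cohomology vanishes in every positive degree. From P_3 on both
outer terms vanish and the middle map is an isomorphism; from P_2 the left term lies in degree 0,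
where this argument says nothing.

The cochain maps commute with the projections to homogeneous parts, which makes the induced maps
degree-preserving. -/

namespace GraphCohomology

open scoped TensorProduct

noncomputable section

/-! ### Signed complexes over a cube of finite sets, and exactness by deletion and contraction. -/

section Cube

variable {R : Type*} [CommRing R] {E : Type*} [LinearOrder E]

variable (R) in
/-- The sign `(-1) ^ #{f ∈ t : f < e}`. -/
def edgeSign (e : E) (t : Finset E) : R := (-1) ^ (t.filter (· < e)).card

theorem edgeSign_mul_self (e : E) (t : Finset E) : edgeSign R e t * edgeSign R e t = 1 := by
  unfold edgeSign
  rw [← pow_add, ← two_mul, pow_mul]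
  simp

theorem edgeSign_eq_prod (e : E) (t : Finset E) :
    edgeSign R e t = ∏ g ∈ t, if g < e then (-1 : R) else 1 := by
  rw [Finset.prod_ite]
  simp [edgeSign]

theorem edgeSign_insert {e g : E} {t : Finset E} (h : g ∉ t) :
    edgeSign R e (insert g t) = (if g < e then (-1 : R) else 1) * edgeSign R e t := by
  rw [edgeSign_eq_prod, edgeSign_eq_prod, Finset.prod_insert h]

theorem edgeSign_insert_self {e : E} {t : Finset E} :
    edgeSign R e (insert e t) = edgeSign R e t := by
  simp [edgeSign, Finset.filter_insert]

theorem edgeSign_anticomm {e g : E} (hne : e ≠ g) {s : Finset E} (he : e ∉ s) (hg : g ∉ s) :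
    edgeSign R e (insert g s) * edgeSign R g s = -(edgeSign R g (insert e s) * edgeSign R e s) := by
  rw [edgeSign_insert he, edgeSign_insert hg]
  rcases lt_or_gt_of_ne hne with h | h
  · simp [h, h.not_gt]; ring
  · simp [h, h.not_gt]; ring

/-- The two orders of removing `e` and `g` carry opposite signs; this is what makes the differential
square to zero. -/
theorem edgeSign_erase_anticomm {e g : E} (hne : e ≠ g) {t : Finset E} (he : e ∈ t) (hg : g ∈ t) :
    edgeSign R e t * edgeSign R g (t.erase e) = -(edgeSign R g t * edgeSign R e (t.erase g)) := by
  obtain ⟨s, hes, hgs, rfl⟩ : ∃ s, e ∉ s ∧ g ∉ s ∧ t = insert e (insert g s) :=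
    ⟨(t.erase e).erase g, by simp, by simp, by
      rw [Finset.insert_erase (Finset.mem_erase.2 ⟨hne.symm, hg⟩), Finset.insert_erase he]⟩
  have h1 : (insert e (insert g s)).erase e = insert g s :=
    Finset.erase_insert (by simp [hne, hes])
  have h2 : (insert e (insert g s)).erase g = insert e s := by
    rw [Finset.insert_comm, Finset.erase_insert (by simp [hne.symm, hgs])]
  rw [h1, h2, edgeSign_insert_self, edgeSign_insert_self, Finset.insert_comm, edgeSign_insert_self,
    edgeSign_insert_self]
  exact edgeSign_anticomm hne hes hgs

variable (R) in
/-- A diagram of `R`-modules indexed by the finite subsets of `E`, ordered by inclusion. Only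
compatibility of the transition maps with composition is required. -/
structure CubeDiagram (F : Finset E → Type*) [∀ s, AddCommGroup (F s)] [∀ s, Module R (F s)] where
  /-- The transition maps. -/
  map : ∀ {s t : Finset E}, s ⊆ t → F s →ₗ[R] F t
  map_map : ∀ {s t u : Finset E} (h : s ⊆ t) (h' : t ⊆ u) (x : F s),
    map h' (map h x) = map (h.trans h') x

namespace CubeDiagram

variable {F : Finset E → Type*} [∀ s, AddCommGroup (F s)] [∀ s, Module R (F s)]
  (D : CubeDiagram R F)

/-- The transition map from `s` to `t`, extended by zero to pairs with `¬ s ⊆ t`. -/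
def transfer (s t : Finset E) : F s →ₗ[R] F t :=
  if h : s ⊆ t then D.map h else 0

theorem transfer_of_subset {s t : Finset E} (h : s ⊆ t) : D.transfer s t = D.map h := dif_pos h

theorem transfer_transfer {s t u : Finset E} (h : s ⊆ t) (h' : t ⊆ u) (x : F s) :
    D.transfer t u (D.transfer s t x) = D.transfer s u x := by
  rw [D.transfer_of_subset h, D.transfer_of_subset h', D.transfer_of_subset (h.trans h'), D.map_map]

/-- The total differential. -/
def d : (∀ s, F s) →ₗ[R] (∀ s, F s) :=
  LinearMap.pi fun t => ∑ e ∈ t,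
    edgeSign R e t • (D.transfer (t.erase e) t ∘ₗ LinearMap.proj (t.erase e))

theorem d_apply (c : ∀ s, F s) (t : Finset E) :
    D.d c t = ∑ e ∈ t, edgeSign R e t • D.transfer (t.erase e) t (c (t.erase e)) := by
  simp [d]

theorem d_d (c : ∀ s, F s) : D.d (D.d c) = 0 := by
  funext t
  have h : D.d (D.d c) t = ∑ e ∈ t, ∑ g ∈ t.erase e,
      (edgeSign R e t * edgeSign R g (t.erase e)) •
        D.transfer ((t.erase e).erase g) t (c ((t.erase e).erase g)) := by
    rw [d_apply]
    refine Finset.sum_congr rfl fun e _ => ?_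
    rw [d_apply, map_sum, Finset.smul_sum]
    refine Finset.sum_congr rfl fun g _ => ?_
    rw [map_smul, D.transfer_transfer (Finset.erase_subset _ _) (Finset.erase_subset _ _), smul_smul]
  rw [h, Finset.sum_sigma']
  refine Finset.sum_involution (fun p _ => ⟨p.2, p.1⟩) ?_ ?_ ?_ ?_
  · rintro ⟨e, g⟩ hp
    simp only [Finset.mem_sigma, Finset.mem_erase] at hp
    obtain ⟨he, hge, hg⟩ := hp
    dsimp only
    rw [Finset.erase_right_comm (a := g), edgeSign_erase_anticomm (Ne.symm hge) he hg, neg_smul,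
      neg_add_cancel]
  · rintro ⟨e, g⟩ hp _ heq
    simp only [Finset.mem_sigma, Finset.mem_erase] at hp
    exact hp.2.1 (congrArg Sigma.fst heq)
  · rintro ⟨e, g⟩ hp
    simp only [Finset.mem_sigma, Finset.mem_erase] at hp ⊢
    exact ⟨hp.2.2, Ne.symm hp.2.1, hp.1⟩
  · rintro ⟨e, g⟩ _
    rfl

/-- `c` vanishes on the sets which do not contain `S`. -/
def SupportedAbove (S : Finset E) (c : ∀ s, F s) : Prop := ∀ s, ¬ S ⊆ s → c s = 0

omit [LinearOrder E] in
theorem supportedAbove_empty (c : ∀ s, F s) : SupportedAbove ∅ c :=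
  fun _ h => (h (Finset.empty_subset _)).elim

theorem SupportedAbove.d {S : Finset E} {c : ∀ s, F s} (h : SupportedAbove S c) :
    SupportedAbove S (D.d c) := by
  intro t ht
  rw [d_apply]
  refine Finset.sum_eq_zero fun e _ => ?_
  rw [h _ fun hs => ht (hs.trans (Finset.erase_subset _ _)), map_zero, smul_zero]

/-- The subquotient complex on the interval `[S, U]` is exact at the sets of cardinality `k`. -/
def ExactAt (S U : Finset E) (k : ℕ) : Prop :=
  ∀ c : ∀ s, F s, SupportedAbove S c → (∀ t ⊆ U, t.card = k + 1 → D.d c t = 0) →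
    ∃ b : ∀ s, F s, SupportedAbove S b ∧ ∀ t ⊆ U, t.card = k → D.d b t = c t

theorem d_congr {c c' : ∀ s, F s} {t : Finset E} (h : ∀ e ∈ t, c (t.erase e) = c' (t.erase e)) :
    D.d c t = D.d c' t := by
  rw [d_apply, d_apply]
  exact Finset.sum_congr rfl fun e he => by rw [h e he]

theorem d_congr_of_card {c c' : ∀ s, F s} {t : Finset E}
    (h : ∀ s, s.card + 1 = t.card → c s = c' s) : D.d c t = D.d c' t :=
  D.d_congr fun _ he => h _ (Finset.card_erase_add_one he)

theorem d_insert_of_eq_zero {c : ∀ s, F s} {e : E} {s : Finset E} (he : e ∉ s)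
    (h : ∀ g ∈ s, c ((insert e s).erase g) = 0) :
    D.d c (insert e s) = edgeSign R e (insert e s) • D.transfer s (insert e s) (c s) := by
  rw [d_apply, Finset.sum_eq_single e, Finset.erase_insert he]
  · intro g hg hge
    rw [h g (Finset.mem_of_mem_insert_of_ne hg hge), map_zero, smul_zero]
  · intro h
    exact (h (Finset.mem_insert_self _ _)).elim

/-- The middle of the long exact sequence: the sets containing `e` form a subcomplex, the sets
avoiding it the quotient. -/
theorem ExactAt.of_delete_of_contract {S U : Finset E} {k : ℕ} {e : E}
    (h₁ : D.ExactAt S (U.erase e) k) (h₂ : D.ExactAt (insert e S) U k) : D.ExactAt S U k := by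
  classical
  intro c hc hdc
  obtain ⟨b, hb, hbc⟩ := h₁ c hc fun t ht => hdc t (ht.trans (Finset.erase_subset _ _))
  -- After subtracting `D.d b` the cochain vanishes on the `k`-sets avoiding `e`, so cutting it down
  -- to sets containing `e` does not affect degree `k` and makes it supported above `insert e S`.
  obtain ⟨b', hb', hbc'⟩ := h₂ (fun t => if e ∈ t then (c - D.d b) t else 0)
    (by
      intro s hs
      by_cases he : e ∈ s
      · have : ¬ S ⊆ s := fun h => hs (Finset.insert_subset he h)
        simp [he, hc s this, hb.d D s this]
      · simp [he])
    (by
      intro t ht hk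
      rw [D.d_congr (c' := c - D.d b), map_sub, D.d_d, sub_zero, hdc t ht hk]
      intro g hg
      split_ifs with he
      · rfl
      · rw [Pi.sub_apply, hbc, sub_self]
        · exact Finset.subset_erase.2 ⟨(Finset.erase_subset _ _).trans ht, he⟩
        · rw [Finset.card_erase_of_mem hg, hk, Nat.add_sub_cancel])
  refine ⟨b + b', ?_, ?_⟩
  · intro s hs
    rw [Pi.add_apply, hb s hs, hb' s fun h => hs ((Finset.subset_insert _ _).trans h), add_zero]
  · intro t ht hk
    rw [map_add, Pi.add_apply, hbc' t ht hk]
    split_ifs with he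
    · simp
    · rw [add_zero, hbc t (Finset.subset_erase.2 ⟨ht, he⟩) hk]

/-- A cochain living only on sets avoiding `e` has a single term in its differential at `insert e
s`, namely the transfer from `s`; surjectivity then allows every value to be prescribed. -/
theorem exists_d_eq_of_surjective {S U : Finset E} {e : E} (he : e ∉ S)
    (hsurj : ∀ s, S ⊆ s → insert e s ⊆ U → e ∉ s →
      Function.Surjective (D.transfer s (insert e s)))
    (c : ∀ s, F s) (hc : SupportedAbove S c) :
    ∃ b : ∀ s, F s, SupportedAbove S b ∧ ∀ t ⊆ U, e ∈ t → D.d b t = c t := by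
  classical
  have H : ∀ s, ∃ x : F s, ((S ⊆ s ∧ insert e s ⊆ U ∧ e ∉ s) →
      D.transfer s (insert e s) x = edgeSign R e (insert e s) • c (insert e s)) ∧
      (¬ (S ⊆ s ∧ insert e s ⊆ U ∧ e ∉ s) → x = 0) := by
    intro s
    by_cases h : S ⊆ s ∧ insert e s ⊆ U ∧ e ∉ s
    · obtain ⟨x, hx⟩ := hsurj s h.1 h.2.1 h.2.2 (edgeSign R e (insert e s) • c (insert e s))
      exact ⟨x, fun _ => hx, fun h' => (h' h).elim⟩
    · exact ⟨0, fun h' => (h h').elim, fun _ => rfl⟩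
  choose b hb hb0 using H
  have hbS : SupportedAbove S b := fun s hs => hb0 s fun h => hs h.1
  refine ⟨b, hbS, ?_⟩
  intro t ht het
  by_cases hSt : S ⊆ t
  · obtain ⟨s, hs, rfl⟩ : ∃ s, e ∉ s ∧ t = insert e s :=
      ⟨t.erase e, by simp, (Finset.insert_erase het).symm⟩
    rw [D.d_insert_of_eq_zero hs, hb s ⟨?_, ht, hs⟩, smul_smul, edgeSign_mul_self, one_smul]
    · exact (Finset.subset_insert_iff_of_notMem he).1 hSt
    · intro g hg
      refine hb0 _ fun h => h.2.2 ?_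
      exact Finset.mem_erase.2 ⟨fun h => hs (h ▸ hg), Finset.mem_insert_self _ _⟩
  · rw [hbS.d D t hSt, hc t hSt]

/-- The interval is the mapping cone of an isomorphism (adding `e`), hence acyclic. -/
theorem exactAt_of_bijective {S U : Finset E} {e : E} (he : e ∉ S) (heU : e ∈ U)
    (hbij : ∀ s, S ⊆ s → insert e s ⊆ U → e ∉ s →
      Function.Bijective (D.transfer s (insert e s))) (k : ℕ) : D.ExactAt S U k := by
  intro c hc hdc
  obtain ⟨b, hb, hbc⟩ := D.exists_d_eq_of_surjective he
    (fun s h₁ h₂ h₃ => (hbij s h₁ h₂ h₃).2) c hc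
  refine ⟨b, hb, fun t ht hk => ?_⟩
  by_cases het : e ∈ t
  · exact hbc t ht het
  by_cases hSt : S ⊆ t
  · have htU : insert e t ⊆ U := Finset.insert_subset heU ht
    -- Once the values on sets containing `e` are cancelled, closedness at `insert e t` says that a
    -- single injective transfer kills the value at `t`.
    have h := D.d_insert_of_eq_zero (c := c - D.d b) het (by
      intro g hg
      rw [Pi.sub_apply, hbc _ ((Finset.erase_subset _ _).trans htU), sub_self]
      exact Finset.mem_erase.2 ⟨fun h => het (h ▸ hg), Finset.mem_insert_self _ _⟩)
    rw [map_sub, D.d_d, sub_zero, hdc _ htU (by rw [Finset.card_insert_of_notMem het, hk])] at h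
    have h2 : D.transfer t (insert e t) ((c - D.d b) t) = 0 := by
      have := congrArg (fun x => edgeSign R e (insert e t) • x) h
      simpa only [smul_smul, edgeSign_mul_self, one_smul, smul_zero] using this.symm
    exact (sub_eq_zero.1 ((hbij t hSt htU het).1 (h2.trans (map_zero _).symm))).symm
  · rw [hb.d D t hSt, hc t hSt]

/-- Adding `e` is a map of complexes from sets avoiding `e` to sets containing it. If it has a
natural section, it is surjective on cohomology, so the connecting maps split and no class comes
from the contraction. -/
theorem exactAt_of_section {U : Finset E} {e : E} {k : ℕ} (heU : e ∈ U)
    (σ : ∀ s, F (insert e s) →ₗ[R] F s)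
    (hσ : ∀ s ⊆ U, e ∉ s → ∀ x, D.transfer s (insert e s) (σ s x) = x)
    (hnat : ∀ s t, s ⊆ t → t ⊆ U → e ∉ t → ∀ x,
      D.transfer s t (σ s x) = σ t (D.transfer (insert e s) (insert e t) x))
    (h : D.ExactAt ∅ (U.erase e) k) : D.ExactAt ∅ U k := by
  classical
  intro c hc hdc
  obtain ⟨b, hb, hbc⟩ := h c hc fun t ht => hdc t (ht.trans (Finset.erase_subset _ _))
  set c' := c - D.d b with hc'
  have hc0 : ∀ t ⊆ U, t.card = k → e ∉ t → c' t = 0 := fun t ht hk het => by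
    rw [hc', Pi.sub_apply, hbc t (Finset.subset_erase.2 ⟨ht, het⟩) hk, sub_self]
  have hdc' : ∀ t ⊆ U, t.card = k + 1 → D.d c' t = 0 := fun t ht hk => by
    rw [hc', map_sub, D.d_d, sub_zero, hdc t ht hk]
  -- The section lifts the part of `c'` on sets containing `e`. On `t` avoiding `e`, naturality
  -- turns the differential of `b'` into the section of the differential of `c'` at `insert e t`,
  -- which is zero.
  let b' : ∀ s, F s := fun s =>
    if e ∈ s then 0 else edgeSign R e (insert e s) • σ s (c' (insert e s))
  have hb'0 : ∀ s, e ∈ s → b' s = 0 := fun s hs => if_pos hs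
  have hb' : ∀ s, e ∉ s → b' s = edgeSign R e (insert e s) • σ s (c' (insert e s)) :=
    fun s hs => if_neg hs
  suffices H : ∀ t ⊆ U, t.card = k → D.d b' t = c' t by
    refine ⟨b + b', supportedAbove_empty _, fun t ht hk => ?_⟩
    rw [map_add, Pi.add_apply, H t ht hk, hc', Pi.sub_apply, add_sub_cancel]
  intro t ht hk
  by_cases het : e ∈ t
  · obtain ⟨s, hs, rfl⟩ : ∃ s, e ∉ s ∧ t = insert e s :=
      ⟨t.erase e, by simp, (Finset.insert_erase het).symm⟩
    rw [D.d_insert_of_eq_zero hs, hb' s hs, map_smul, smul_smul, edgeSign_mul_self, one_smul,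
      hσ s ((Finset.subset_insert _ _).trans ht) hs]
    intro g hg
    exact hb'0 _ (Finset.mem_erase.2 ⟨fun h => hs (h ▸ hg), Finset.mem_insert_self _ _⟩)
  · have h1 : D.d b' t = -(edgeSign R e (insert e t) • σ t (D.d c' (insert e t))) := by
      rw [d_apply, d_apply, Finset.sum_insert het, Finset.erase_insert het, hc0 t ht hk het, map_zero,
        smul_zero, zero_add, map_sum, Finset.smul_sum, ← Finset.sum_neg_distrib]
      refine Finset.sum_congr rfl fun g hg => ?_
      have hge : e ≠ g := fun h => het (h ▸ hg)
      have h2 : insert e (t.erase g) = (insert e t).erase g :=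
        (Finset.erase_insert_of_ne hge).symm
      have h3 : e ∉ t.erase g := fun h => het (Finset.mem_of_mem_erase h)
      rw [hb' _ h3, map_smul, smul_smul, hnat _ _ (Finset.erase_subset _ _) ht het, map_smul,
        smul_smul, ← neg_smul, h2]
      congr 1
      have h4 := edgeSign_erase_anticomm (R := R) hge (Finset.mem_insert_self e t)
        (Finset.mem_insert_of_mem hg)
      rw [Finset.erase_insert het] at h4
      have h5 := edgeSign_mul_self (R := R) g t
      have h6 := edgeSign_mul_self (R := R) g (insert e t)
      linear_combination (edgeSign R g t * edgeSign R e ((insert e t).erase g)) * (- h6)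
        + edgeSign R g t * edgeSign R g (insert e t) * h4
        - (edgeSign R e (insert e t) * edgeSign R g (insert e t)) * h5
    rw [h1, hdc' _ (Finset.insert_subset heU ht) (by rw [Finset.card_insert_of_notMem het, hk]),
      map_zero, smul_zero, neg_zero, hc0 t ht hk het]

theorem exactAt_of_card_lt {S U : Finset E} {k : ℕ} (h : U.card < k) : D.ExactAt S U k :=
  fun _ _ _ => ⟨0, fun _ _ => rfl, fun _ ht hk =>
    absurd (Finset.card_le_card ht) (by omega)⟩

/-- Exactness in large degrees: a deletion-contraction argument. -/
theorem exactAt_of_rank (N : Finset E → ℕ) (hN : ∀ s t, s ⊆ t → N t ≤ N s)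
    (hsurj : ∀ s e, Function.Surjective (D.transfer s (insert e s)))
    (hN' : ∀ S e, (∀ s, S ⊆ s → Function.Bijective (D.transfer s (insert e s))) ∨
      N (insert e S) < N S) {k : ℕ} :
    ∀ {S U : Finset E}, S ⊂ U → S.card + N S ≤ k + N U → D.ExactAt S U k := by
  intro S U
  induction hT : (U \ S).card generalizing S U with
  | zero =>
    intro h _
    exact (h.2 (Finset.sdiff_eq_empty_iff_subset.1 (Finset.card_eq_zero.1 hT))).elim
  | succ m ih =>
    intro hSU hk
    obtain ⟨e, heU, heS⟩ := Finset.exists_of_ssubset hSU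
    rcases hN' S e with hbij | hlt
    · exact D.exactAt_of_bijective heS heU (fun s hs _ _ => hbij s hs) k
    have hins : insert e S ⊆ U := Finset.insert_subset heU hSU.1
    -- Here only the two terms at `S` and `insert e S` remain. The strict drop of `N` gives `S.card
    -- < k`, so only the target of a surjection matters.
    by_cases hU : insert e S = U
    · subst hU
      intro c hc _
      obtain ⟨b, hb, hbc⟩ := D.exists_d_eq_of_surjective heS (U := insert e S)
        (fun s _ _ _ => hsurj s e) c hc
      refine ⟨b, hb, fun t ht htk => ?_⟩
      by_cases het : e ∈ t
      · exact hbc t ht het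
      · have := Finset.card_le_card ((Finset.subset_insert_iff_of_notMem het).1 ht)
        omega
    · have hsd : (U \ S).erase e = U \ insert e S := by
        ext x; simp only [Finset.mem_erase, Finset.mem_sdiff, Finset.mem_insert]; tauto
      have hsd' : (U \ S).erase e = U.erase e \ S := by
        ext x; simp only [Finset.mem_erase, Finset.mem_sdiff]; tauto
      have hcard : ((U \ S).erase e).card = m := by
        rw [Finset.card_erase_of_mem (Finset.mem_sdiff.2 ⟨heU, heS⟩), hT, Nat.add_sub_cancel]
      -- Deleting `e` can only raise `N` of the top set; contracting it raises `S.card` by one, but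
      -- lowers `N S` by at least one. The numerical bound persists in both cases.
      refine ExactAt.of_delete_of_contract D (e := e) (ih (hsd' ▸ hcard) ?_ ?_)
        (ih (hsd ▸ hcard) (Finset.ssubset_iff_subset_ne.2 ⟨hins, hU⟩) ?_)
      · refine Finset.ssubset_iff_subset_ne.2 ⟨Finset.subset_erase.2 ⟨hSU.1, heS⟩, ?_⟩
        rintro rfl
        exact hU (Finset.insert_erase heU)
      · have := hN (U.erase e) U (Finset.erase_subset _ _)
        omega
      · rw [Finset.card_insert_of_notMem heS]
        omega

end CubeDiagram

end Cube

/-! ### Functoriality of merging tensor factors. -/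

section Merge

variable (R : Type*) [CommRing R] (A : Type*) [CommRing A] [Algebra R A]

theorem mergeMap_mergeMap {ι κ τ : Type*} [Finite ι] [Finite κ] (p : κ → τ) (q : ι → κ)
    (x : ⨂[R] _ : ι, A) : mergeMap R A p (mergeMap R A q x) = mergeMap R A (p ∘ q) x := by
  classical
  let _ := Fintype.ofFinite ι
  let _ := Fintype.ofFinite κ
  suffices h : mergeMap R A p ∘ₗ mergeMap R A q = mergeMap R A (p ∘ q) from
    LinearMap.congr_fun h x
  refine PiTensorProduct.ext (MultilinearMap.ext fun a => ?_)
  simp only [LinearMap.compMultilinearMap_apply, LinearMap.comp_apply, mergeMap_tprod]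
  congr 1
  funext k
  have h := Finset.prod_fiberwise_eq_prod_filter Finset.univ (Finset.univ.filter (p · = k)) q a
  simp only [Finset.mem_filter, Finset.mem_univ, true_and] at h
  exact h

theorem mergeMap_id {ι : Type*} [Finite ι] (x : ⨂[R] _ : ι, A) : mergeMap R A (id : ι → ι) x = x := by
  classical
  let _ := Fintype.ofFinite ι
  suffices h : mergeMap R A (id : ι → ι) = LinearMap.id from LinearMap.congr_fun h x
  refine PiTensorProduct.ext (MultilinearMap.ext fun a => ?_)
  simp only [LinearMap.compMultilinearMap_apply, mergeMap_tprod, LinearMap.id_apply, id]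
  congr 1
  funext k
  rw [Finset.prod_filter, Finset.prod_eq_single k] <;> simp +contextual

theorem mergeMap_surjective {ι κ : Type*} [Finite ι] [Finite κ] {q : ι → κ}
    (hq : Function.Surjective q) : Function.Surjective (mergeMap R A q) := by
  intro x
  obtain ⟨p, hp⟩ := hq.hasRightInverse
  refine ⟨mergeMap R A p x, ?_⟩
  rw [mergeMap_mergeMap, show q ∘ p = id from funext hp, mergeMap_id]

theorem mergeMap_bijective {ι κ : Type*} [Finite ι] [Finite κ] {q : ι → κ}
    (hq : Function.Bijective q) : Function.Bijective (mergeMap R A q) := by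
  refine ⟨?_, mergeMap_surjective R A hq.2⟩
  obtain ⟨p, hp, -⟩ := Function.bijective_iff_has_inverse.1 hq
  refine Function.LeftInverse.injective (g := mergeMap R A p) fun x => ?_
  rw [mergeMap_mergeMap, show p ∘ q = id from funext hp, mergeMap_id]

end Merge

/-! ### Projections of tensor powers onto homogeneous parts. -/

section Degree

variable {R : Type*} [CommRing R] {A : Type*} [CommRing A] [Algebra R A]
  (𝒜 : ℕ → Submodule R A) [GradedAlgebra 𝒜]

open Classical in
/-- The projection of `⨂_ι A` onto its homogeneous part of degree `j`. -/
def tensorProj (ι : Type*) [Finite ι] (j : ℕ) : (⨂[R] _ : ι, A) →ₗ[R] (⨂[R] _ : ι, A) :=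
  letI := Fintype.ofFinite ι
  ∑ k ∈ Finset.piAntidiag (Finset.univ : Finset ι) j,
    PiTensorProduct.map fun i => GradedAlgebra.proj 𝒜 (k i)

theorem tensorProj_tprod_of_homogeneous {ι : Type*} [Fintype ι] {k : ι → ℕ} {a : ι → A}
    (ha : ∀ i, a i ∈ 𝒜 (k i)) (j : ℕ) :
    tensorProj 𝒜 ι j (PiTensorProduct.tprod R a) =
      if ∑ i, k i = j then PiTensorProduct.tprod R a else 0 := by
  classical
  have key : ∀ k' : ι → ℕ, PiTensorProduct.map (fun i => GradedAlgebra.proj 𝒜 (k' i))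
      (PiTensorProduct.tprod R a) = if k' = k then PiTensorProduct.tprod R a else 0 := by
    intro k'
    rw [PiTensorProduct.map_tprod]
    split_ifs with h
    · subst h
      congr 1
      funext i
      rw [GradedAlgebra.proj_apply, DirectSum.decompose_of_mem_same _ (ha i)]
    · obtain ⟨i, hi⟩ := Function.ne_iff.1 h
      refine MultilinearMap.map_coord_zero _ i ?_
      rw [GradedAlgebra.proj_apply, DirectSum.decompose_of_mem_ne _ (ha i) (Ne.symm hi)]
  rw [tensorProj, LinearMap.sum_apply]
  simp only [key, Finset.sum_ite_eq', Finset.mem_piAntidiag]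
  refine if_congr ?_ rfl rfl
  simp only [Finset.mem_univ, implies_true, and_true]
  exact Eq.congr_left (Finset.sum_congr (by ext; simp) fun _ _ => rfl)

omit [GradedAlgebra 𝒜] in
theorem tprod_mem_tensorDegree {ι : Type*} [Fintype ι] {k : ι → ℕ} {a : ι → A}
    (ha : ∀ i, a i ∈ 𝒜 (k i)) {j : ℕ} (hj : ∑ i, k i = j) :
    PiTensorProduct.tprod R a ∈ tensorDegree 𝒜 ι j := by
  refine Submodule.subset_span ⟨k, a, ha, ?_, rfl⟩
  rw [← hj]
  exact Finset.sum_congr (by ext; simp) fun _ _ => rfl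

/-- A linear map out of `⨂_ι A` is determined by its values on tensors of homogeneous elements. -/
theorem tensor_hom_ext_homogeneous {ι M : Type*} [Finite ι] [AddCommGroup M] [Module R M]
    {f g : (⨂[R] _ : ι, A) →ₗ[R] M}
    (h : ∀ (k : ι → ℕ) (a : ι → A), (∀ i, a i ∈ 𝒜 (k i)) →
      f (PiTensorProduct.tprod R a) = g (PiTensorProduct.tprod R a)) : f = g := by
  classical
  let _ := Fintype.ofFinite ι
  refine PiTensorProduct.ext (MultilinearMap.ext fun a => ?_)
  simp only [LinearMap.compMultilinearMap_apply]
  have ha : a = fun i => ∑ k ∈ (DirectSum.decompose 𝒜 (a i)).support,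
      (DirectSum.decompose 𝒜 (a i) k : A) :=
    funext fun i => (DirectSum.sum_support_decompose 𝒜 (a i)).symm
  have hs : PiTensorProduct.tprod R a =
      ∑ k ∈ Fintype.piFinset fun i => (DirectSum.decompose 𝒜 (a i)).support,
        PiTensorProduct.tprod R fun i => (DirectSum.decompose 𝒜 (a i) (k i) : A) := by
    conv_lhs => rw [ha]
    exact MultilinearMap.map_sum_finset _ _ _
  rw [hs, map_sum, map_sum]
  exact Finset.sum_congr rfl fun k _ => h k _ fun i => SetLike.coe_mem _

theorem tensorProj_of_mem {ι : Type*} [Finite ι] {j : ℕ} {z : ⨂[R] _ : ι, A}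
    (hz : z ∈ tensorDegree 𝒜 ι j) : tensorProj 𝒜 ι j z = z := by
  let _ := Fintype.ofFinite ι
  refine LinearMap.eqOn_span (f := tensorProj 𝒜 ι j) (g := LinearMap.id) ?_ hz
  rintro _ ⟨k, a, ha, hj, rfl⟩
  rw [tensorProj_tprod_of_homogeneous 𝒜 ha, if_pos hj, LinearMap.id_apply]

theorem tensorProj_mem {ι : Type*} [Finite ι] (j : ℕ) (z : ⨂[R] _ : ι, A) :
    tensorProj 𝒜 ι j z ∈ tensorDegree 𝒜 ι j := by
  let _ := Fintype.ofFinite ι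
  suffices h : (tensorDegree 𝒜 ι j).mkQ ∘ₗ tensorProj 𝒜 ι j = 0 by
    simpa using LinearMap.congr_fun h z
  refine tensor_hom_ext_homogeneous 𝒜 fun k a ha => ?_
  rw [LinearMap.comp_apply, tensorProj_tprod_of_homogeneous 𝒜 ha]
  split_ifs with hj
  · simpa using tprod_mem_tensorDegree 𝒜 ha hj
  · simp

/-- Multiplication in a graded algebra adds degrees, so merging factors preserves the total degree
of a homogeneous tensor. -/
theorem tensorProj_mergeMap {ι κ : Type*} [Finite ι] [Finite κ] (q : ι → κ) (j : ℕ)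
    (z : ⨂[R] _ : ι, A) :
    tensorProj 𝒜 κ j (mergeMap R A q z) = mergeMap R A q (tensorProj 𝒜 ι j z) := by
  classical
  let _ := Fintype.ofFinite ι
  let _ := Fintype.ofFinite κ
  suffices h : tensorProj 𝒜 κ j ∘ₗ mergeMap R A q = mergeMap R A q ∘ₗ tensorProj 𝒜 ι j from
    LinearMap.congr_fun h z
  refine tensor_hom_ext_homogeneous 𝒜 fun k a ha => ?_
  rw [LinearMap.comp_apply, LinearMap.comp_apply, tensorProj_tprod_of_homogeneous 𝒜 ha,
    mergeMap_tprod, tensorProj_tprod_of_homogeneous 𝒜 (k := fun c => ∑ i with q i = c, k i)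
      fun c => SetLike.prod_mem_graded _ _ _ fun i _ => ha i]
  have hk : ∑ c, ∑ i with q i = c, k i = ∑ i, k i := Finset.sum_fiberwise _ _ _
  rw [hk]
  split_ifs
  · rw [mergeMap_tprod]
  · rw [map_zero]

end Degree

/-! ### The cochain complex of a graph as a cube complex. -/

section Total

variable (R : Type*) [CommRing R] (A : Type*) [CommRing A] [Algebra R A]
  {α β : Type*} (G : Graph α β)

theorem Comp.incl_incl {s t u : Finset G.edgeSet} (h : s ⊆ t) (h' : t ⊆ u) (x : Comp G s) :
    Comp.incl G h' (Comp.incl G h x) = Comp.incl G (h.trans h') x := by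
  induction x using Quot.ind
  rfl

/-- The diagram of the tensor powers `A^{⊗ k(s)}`, for the edge sets `s` of `G`. -/
def graphDiagram [Finite G.vertexSet] :
    CubeDiagram R (fun s : Finset G.edgeSet => ⨂[R] _ : Comp G s, A) where
  map h := mergeMap R A (Comp.incl G h)
  map_map h h' x := by
    rw [mergeMap_mergeMap]
    congr 1
    exact congrArg _ (funext (Comp.incl_incl G h h'))

/-- Cochains without restriction on the degree. -/
abbrev TotalCochain : Type _ := (s : Finset G.edgeSet) → ⨂[R] _ : Comp G s, A

/-- Extension by zero of a cochain of degree `i`. -/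
def extendZero (i : ℕ) : Cochain R A G i →ₗ[R] TotalCochain R A G :=
  LinearMap.pi fun s => if h : s.card = i then
    LinearMap.proj (⟨s, h⟩ : {s : Finset G.edgeSet // s.card = i}) else 0

/-- The component of degree `i` of a cochain. -/
def component (i : ℕ) : TotalCochain R A G →ₗ[R] Cochain R A G i :=
  LinearMap.pi fun s => LinearMap.proj s.1

variable {R A G}

theorem extendZero_apply {i : ℕ} (c : Cochain R A G i) {s : Finset G.edgeSet} (h : s.card = i) :
    extendZero R A G i c s = c ⟨s, h⟩ := by
  simp [extendZero, h]

theorem extendZero_apply_of_ne {i : ℕ} (c : Cochain R A G i) {s : Finset G.edgeSet}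
    (h : s.card ≠ i) : extendZero R A G i c s = 0 := by
  simp [extendZero, h]

theorem component_apply {i : ℕ} (c : TotalCochain R A G) (s : {s : Finset G.edgeSet // s.card = i}) :
    component R A G i c s = c s.1 := rfl

theorem extendZero_component_apply {i : ℕ} (c : TotalCochain R A G) {s : Finset G.edgeSet}
    (h : s.card = i) : extendZero R A G i (component R A G i c) s = c s :=
  extendZero_apply _ h

variable [LinearOrder β] [Finite G.vertexSet]

theorem differential_apply_eq {i : ℕ} (c : Cochain R A G i)
    (t : {t : Finset G.edgeSet // t.card = i + 1}) :
    differential R A G i c t = (graphDiagram R A G).d (extendZero R A G i c) t.1 := by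
  rw [CubeDiagram.d_apply, ← Finset.sum_coe_sort]
  simp only [differential, LinearMap.pi_apply, LinearMap.sum_apply, LinearMap.smul_apply,
    LinearMap.comp_apply]
  refine Finset.sum_congr rfl fun e _ => ?_
  rw [CubeDiagram.transfer_of_subset _ (Finset.erase_subset _ _), extendZero_apply]
  rfl

theorem graphDiagram_d_extendZero_of_ne {i : ℕ} (c : Cochain R A G i) {t : Finset G.edgeSet}
    (h : t.card ≠ i + 1) : (graphDiagram R A G).d (extendZero R A G i c) t = 0 := by
  rw [CubeDiagram.d_congr_of_card (c' := 0), map_zero]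
  · rfl
  · exact fun s hs => extendZero_apply_of_ne c (by omega)

theorem mem_ker_differential_iff {i : ℕ} (c : Cochain R A G i) :
    c ∈ LinearMap.ker (differential R A G i) ↔
      (graphDiagram R A G).d (extendZero R A G i c) = 0 := by
  rw [LinearMap.mem_ker]
  constructor
  · intro h
    funext t
    by_cases ht : t.card = i + 1
    · rw [← differential_apply_eq c ⟨t, ht⟩, h]
      rfl
    · exact graphDiagram_d_extendZero_of_ne c ht
  · intro h
    funext t
    rw [differential_apply_eq, h]
    rfl

/-- With `mem_coboundaries_iff` this moves cocycles and coboundaries to `TotalCochain`, where no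
cardinality proofs appear in the indices. -/
theorem component_mem_ker_iff {i : ℕ} (c : TotalCochain R A G) :
    component R A G i c ∈ LinearMap.ker (differential R A G i) ↔
      ∀ t : Finset G.edgeSet, t.card = i + 1 → (graphDiagram R A G).d c t = 0 := by
  have key : ∀ t : Finset G.edgeSet, t.card = i + 1 →
      (graphDiagram R A G).d (extendZero R A G i (component R A G i c)) t =
        (graphDiagram R A G).d c t := fun t ht => CubeDiagram.d_congr_of_card _ fun s hs =>
    extendZero_component_apply c (by omega)
  rw [mem_ker_differential_iff]
  constructor
  · intro h t ht
    rw [← key t ht, h]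
    rfl
  · intro h
    funext t
    by_cases ht : t.card = i + 1
    · rw [key t ht, h t ht]
      rfl
    · exact graphDiagram_d_extendZero_of_ne _ ht

theorem mem_coboundaries_iff {i : ℕ} (c : Cochain R A G i) :
    c ∈ coboundaries R A G i ↔
      ∃ b : TotalCochain R A G, component R A G i ((graphDiagram R A G).d b) = c := by
  cases i with
  | zero =>
    constructor
    · intro h
      exact ⟨0, by rw [map_zero, map_zero, (Submodule.mem_bot R).1 h]⟩
    · rintro ⟨b, rfl⟩
      refine (Submodule.mem_bot R).2 (funext fun s => ?_)
      obtain ⟨s, hs⟩ := s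
      obtain rfl := Finset.card_eq_zero.1 hs
      rw [component_apply, CubeDiagram.d_apply, Finset.sum_empty]
      rfl
  | succ i =>
    constructor
    · rintro ⟨b, rfl⟩
      exact ⟨extendZero R A G i b, funext fun t => (differential_apply_eq b t).symm⟩
    · rintro ⟨b, rfl⟩
      refine ⟨component R A G i b, funext fun t => ?_⟩
      rw [differential_apply_eq, component_apply]
      have ht := t.2
      exact CubeDiagram.d_congr_of_card _ fun s hs => extendZero_component_apply _ (by omega)

variable (𝒜 : ℕ → Submodule R A) [GradedAlgebra 𝒜]

variable (G) in
/-- The projection of the cochains of `G` onto their homogeneous part of degree `j`. -/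
def cochainProj (j : ℕ) : TotalCochain R A G →ₗ[R] TotalCochain R A G :=
  LinearMap.pi fun s => tensorProj 𝒜 (Comp G s) j ∘ₗ LinearMap.proj s

omit [LinearOrder β] in
theorem cochainProj_apply (j : ℕ) (c : TotalCochain R A G) (s : Finset G.edgeSet) :
    cochainProj G 𝒜 j c s = tensorProj 𝒜 (Comp G s) j (c s) := rfl

theorem cochainProj_d (j : ℕ) (c : TotalCochain R A G) :
    cochainProj G 𝒜 j ((graphDiagram R A G).d c) = (graphDiagram R A G).d (cochainProj G 𝒜 j c) := by
  funext t
  rw [cochainProj_apply, CubeDiagram.d_apply, CubeDiagram.d_apply, map_sum]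
  refine Finset.sum_congr rfl fun e _ => ?_
  rw [map_smul, CubeDiagram.transfer_of_subset _ (Finset.erase_subset _ _), cochainProj_apply]
  congr 1
  exact tensorProj_mergeMap 𝒜 _ _ _

end Total

/-! ### Graded maps on cohomology induced by cochain maps. -/

section InducedMap

variable {R : Type*} [CommRing R] {A : Type*} [CommRing A] [Algebra R A]
  (𝒜 : ℕ → Submodule R A)

/-- There is a degree-preserving epimorphism `H^i(G) → H^{i'}(K)`. -/
def HasGradedEpi {α β α' β' : Type*} [LinearOrder β] [LinearOrder β']
    (G : Graph α β) [Finite G.vertexSet] (i : ℕ) (K : Graph α' β') [Finite K.vertexSet] (i' : ℕ) :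
    Prop :=
  ∃ f : Cohomology R A G i →ₗ[R] Cohomology R A K i', Function.Surjective f ∧
    ∀ j, (cohomologyDegree G 𝒜 i j).map f = cohomologyDegree K 𝒜 i' j

/-- There is a degree-preserving isomorphism `H^i(G) ≃ H^{i'}(K)`. -/
def HasGradedIso {α β α' β' : Type*} [LinearOrder β] [LinearOrder β']
    (G : Graph α β) [Finite G.vertexSet] (i : ℕ) (K : Graph α' β') [Finite K.vertexSet] (i' : ℕ) :
    Prop :=
  ∃ φ : Cohomology R A G i ≃ₗ[R] Cohomology R A K i',
    ∀ j, (cohomologyDegree G 𝒜 i j).map φ.toLinearMap = cohomologyDegree K 𝒜 i' j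

section

variable {α β α' β' α'' β'' : Type*} [LinearOrder β] [LinearOrder β'] [LinearOrder β'']
  {G : Graph α β} [Finite G.vertexSet] {K : Graph α' β'} [Finite K.vertexSet]
  {L : Graph α'' β''} [Finite L.vertexSet] {i i' i'' : ℕ}

variable (G i) in
theorem HasGradedIso.refl : HasGradedIso 𝒜 G i G i :=
  ⟨LinearEquiv.refl R _, fun _ => Submodule.map_id _⟩

variable {𝒜}

theorem HasGradedIso.symm (h : HasGradedIso 𝒜 G i K i') : HasGradedIso 𝒜 K i' G i := by
  obtain ⟨φ, hφ⟩ := h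
  refine ⟨φ.symm, fun j => ?_⟩
  rw [← hφ j, ← Submodule.map_comp]
  simp

theorem HasGradedIso.trans (h : HasGradedIso 𝒜 G i K i') (h' : HasGradedIso 𝒜 K i' L i'') :
    HasGradedIso 𝒜 G i L i'' := by
  obtain ⟨φ, hφ⟩ := h
  obtain ⟨ψ, hψ⟩ := h'
  refine ⟨φ.trans ψ, fun j => ?_⟩
  rw [← hψ j, ← hφ j, ← Submodule.map_comp]
  rfl

theorem HasGradedIso.hasGradedEpi (h : HasGradedIso 𝒜 G i K i') : HasGradedEpi 𝒜 G i K i' :=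
  h.elim fun φ hφ => ⟨φ.toLinearMap, φ.surjective, hφ⟩

theorem HasGradedEpi.trans (h : HasGradedEpi 𝒜 G i K i') (h' : HasGradedEpi 𝒜 K i' L i'') :
    HasGradedEpi 𝒜 G i L i'' := by
  obtain ⟨f, hf, hfj⟩ := h
  obtain ⟨g, hg, hgj⟩ := h'
  refine ⟨g ∘ₗ f, hg.comp hf, fun j => ?_⟩
  rw [← hgj j, ← hfj j, ← Submodule.map_comp]

end

variable [GradedAlgebra 𝒜] {α β α' β' : Type*} [LinearOrder β] [LinearOrder β']
  {G : Graph α β} [Finite G.vertexSet] {K : Graph α' β'} [Finite K.vertexSet]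

/-- A degree-preserving map of complexes of degree `k` that is surjective on cohomology in
degree `i` induces a graded epimorphism there, which is an isomorphism if the map is also injective
on cohomology. -/
theorem exists_cohomology_map (Φ : TotalCochain R A G →ₗ[R] TotalCochain R A K) (i k : ℕ)
    (hd : ∀ c, (graphDiagram R A K).d (Φ c) = Φ ((graphDiagram R A G).d c))
    (hcard : ∀ c t, (∀ s : Finset G.edgeSet, s.card + k = t.card → c s = 0) → Φ c t = 0)
    (hproj : ∀ j c, Φ (cochainProj G 𝒜 j c) = cochainProj K 𝒜 j (Φ c))
    (hsurj : ∀ z : TotalCochain R A K, (graphDiagram R A K).d z = 0 → ∃ (y : TotalCochain R A G)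
      (b : TotalCochain R A K), (∀ s, s.card = i + 1 → (graphDiagram R A G).d y s = 0) ∧
        ∀ t, t.card = i + k → z t - Φ y t = (graphDiagram R A K).d b t) :
    HasGradedEpi 𝒜 G i K (i + k) ∧
    ((∀ y : TotalCochain R A G, (∀ s, s.card = i + 1 → (graphDiagram R A G).d y s = 0) →
        (∃ b, ∀ t, t.card = i + k → Φ y t = (graphDiagram R A K).d b t) →
          ∃ b, ∀ s, s.card = i → y s = (graphDiagram R A G).d b s) →
      HasGradedIso 𝒜 G i K (i + k)) := by
  let φ := component R A K (i + k) ∘ₗ Φ ∘ₗ extendZero R A G i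
  have hΦ : ∀ c c' : TotalCochain R A G, (∀ s, s.card = i → c s = c' s) →
      ∀ t, t.card = i + k → Φ c t = Φ c' t := by
    intro c c' h t ht
    have := hcard (c - c') t fun s hs => by
      rw [Pi.sub_apply, h s (by omega), sub_self]
    rwa [map_sub, Pi.sub_apply, sub_eq_zero] at this
  have hφ : ∀ c : TotalCochain R A G, φ (component R A G i c) = component R A K (i + k) (Φ c) :=
    fun c => funext fun t => hΦ _ _ (fun s hs => extendZero_component_apply c hs) t.1 t.2
  have hker : ∀ c ∈ LinearMap.ker (differential R A G i),
      φ c ∈ LinearMap.ker (differential R A K (i + k)) := by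
    intro c hc
    refine (component_mem_ker_iff _).2 fun t _ => ?_
    change (graphDiagram R A K).d (Φ (extendZero R A G i c)) t = 0
    rw [hd, (mem_ker_differential_iff c).1 hc, map_zero]
    rfl
  have hcob : ∀ c ∈ coboundaries R A G i, φ c ∈ coboundaries R A K (i + k) := by
    intro c hc
    obtain ⟨b, rfl⟩ := (mem_coboundaries_iff c).1 hc
    rw [hφ, ← hd]
    exact (mem_coboundaries_iff _).2 ⟨_, rfl⟩
  let f : Cohomology R A G i →ₗ[R] Cohomology R A K (i + k) :=
    Submodule.mapQ _ _ (φ.restrict hker) fun c hc => hcob _ hc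
  have hf : ∀ c hc, f (Submodule.Quotient.mk ⟨c, hc⟩) = Submodule.Quotient.mk ⟨φ c, hker c hc⟩ :=
    fun c hc => Submodule.mapQ_apply _ _ _ _
  have heq : ∀ c c' : LinearMap.ker (differential R A K (i + k)),
      c.1 - c'.1 ∈ coboundaries R A K (i + k) →
        (Submodule.Quotient.mk c : Cohomology R A K (i + k)) = Submodule.Quotient.mk c' :=
    fun c c' h => (Submodule.Quotient.eq _).2 h
  have hpre : ∀ z : LinearMap.ker (differential R A K (i + k)), ∃ (y : TotalCochain R A G)
      (b : TotalCochain R A K), (∀ s, s.card = i + 1 → (graphDiagram R A G).d y s = 0) ∧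
        z.1 - φ (component R A G i y) = component R A K (i + k) ((graphDiagram R A K).d b) := by
    rintro ⟨z, hz⟩
    obtain ⟨y, b, hy, hyb⟩ := hsurj _ ((mem_ker_differential_iff z).1 hz)
    refine ⟨y, b, hy, funext fun t => ?_⟩
    rw [hφ, component_apply, ← hyb t.1 t.2, extendZero_apply z t.2]
    rfl
  have hfs : Function.Surjective f := by
    intro z
    obtain ⟨z, rfl⟩ := Submodule.Quotient.mk_surjective _ z
    obtain ⟨y, b, hy, hyb⟩ := hpre z
    refine ⟨Submodule.Quotient.mk ⟨_, (component_mem_ker_iff y).2 hy⟩, ?_⟩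
    rw [hf]
    exact (heq _ _ ((mem_coboundaries_iff _).2 ⟨b, hyb.symm⟩)).symm
  have hfj : ∀ j, (cohomologyDegree G 𝒜 i j).map f = cohomologyDegree K 𝒜 (i + k) j := by
    intro j
    apply le_antisymm
    · rintro _ ⟨_, ⟨⟨y, hy⟩, hyj, rfl⟩, rfl⟩
      refine ⟨⟨φ y, hker y hy⟩, ?_, rfl⟩
      have hyj' : ∀ s, y s ∈ tensorDegree 𝒜 (Comp G s.1) j := fun s => hyj s trivial
      have h1 : y = component R A G i (cochainProj G 𝒜 j (extendZero R A G i y)) := by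
        funext s
        rw [component_apply, cochainProj_apply, extendZero_apply y s.2, tensorProj_of_mem 𝒜 (hyj' s)]
      intro t _
      change φ y t ∈ _
      rw [h1, hφ, hproj]
      exact tensorProj_mem 𝒜 _ _
    · rintro _ ⟨⟨z, hz⟩, hzj, rfl⟩
      have hzj' : ∀ s, z s ∈ tensorDegree 𝒜 (Comp K s.1) j := fun s => hzj s trivial
      obtain ⟨y, b, hy, hyb⟩ := hpre ⟨z, hz⟩
      -- A preimage of a homogeneous class need not be homogeneous, but its degree `j` part is still
      -- a cocycle and still a preimage: project the relation `hyb` to degree `j`.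
      have hy' : ∀ s, s.card = i + 1 →
          (graphDiagram R A G).d (cochainProj G 𝒜 j y) s = 0 := by
        intro s hs
        rw [← cochainProj_d, cochainProj_apply, hy s hs, map_zero]
      refine ⟨_, ⟨⟨component R A G i (cochainProj G 𝒜 j y), (component_mem_ker_iff _).2 hy'⟩,
        fun s _ => tensorProj_mem 𝒜 _ _, rfl⟩, ?_⟩
      refine (hf _ _).trans (heq _ _ ?_).symm
      refine (mem_coboundaries_iff _).2 ⟨cochainProj K 𝒜 j b, ?_⟩
      funext t
      have h2 := congrArg (tensorProj 𝒜 (Comp K t.1) j) (congrFun hyb t)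
      rw [hφ] at h2
      rw [← cochainProj_d]
      refine h2.symm.trans ?_
      rw [Pi.sub_apply, map_sub, tensorProj_of_mem 𝒜 (hzj' t)]
      change _ = z t - φ (component R A G i (cochainProj G 𝒜 j y)) t
      rw [hφ, hproj]
      rfl
  refine ⟨⟨f, hfs, hfj⟩, fun hinj => ?_⟩
  have hfi : Function.Injective f := by
    refine (injective_iff_map_eq_zero f).2 fun y hy0 => ?_
    obtain ⟨⟨y, hy⟩, rfl⟩ := Submodule.Quotient.mk_surjective _ y
    rw [hf, Submodule.Quotient.mk_eq_zero] at hy0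
    obtain ⟨b, hb⟩ := (mem_coboundaries_iff _).1 hy0
    obtain ⟨b', hb'⟩ := hinj (extendZero R A G i y)
      (fun s _ => congrFun ((mem_ker_differential_iff y).1 hy) s)
      ⟨b, fun t ht => (congrFun hb ⟨t, ht⟩).symm⟩
    rw [Submodule.Quotient.mk_eq_zero]
    refine (mem_coboundaries_iff y).2 ⟨b', funext fun s => ?_⟩
    rw [component_apply, ← hb' s.1 s.2, extendZero_apply y s.2]
  exact ⟨LinearEquiv.ofBijective f ⟨hfi, hfs⟩, hfj⟩

end InducedMap

/-- The decidable equality of edges that is part of their linear order. -/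
local instance (priority := 2000) edgeSetDecidableEq {α β : Type*} [LinearOrder β]
    (G : Graph α β) : DecidableEq G.edgeSet := LinearOrder.toDecidableEq

/-! ### Vanishing of graph cohomology above the rank, and pendant edges. -/

section Exactness

variable {α β α' β' : Type*} {G : Graph α β} {K : Graph α' β'}

/-- The component of a vertex. -/
def Comp.mk (s : Finset G.edgeSet) (x : G.vertexSet) : Comp G s := Quot.mk _ x

theorem Comp.mk_eq_mk {s : Finset G.edgeSet} {e : G.edgeSet} (he : e ∈ s) {x y : G.vertexSet}
    (h : G.IsLink e x y) : Comp.mk s x = Comp.mk s y :=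
  Quot.sound ⟨e, he, h⟩

theorem Comp.mk_surjective (s : Finset G.edgeSet) : Function.Surjective (Comp.mk s) :=
  Quot.mk_surjective

/-- The map on components induced by a map on vertices. -/
def Comp.map (q : G.vertexSet → K.vertexSet) (s : Finset G.edgeSet) (t : Finset K.edgeSet)
    (h : ∀ e ∈ s, ∀ x y : G.vertexSet, G.IsLink e x y → Comp.mk t (q x) = Comp.mk t (q y)) :
    Comp G s → Comp K t :=
  Quot.lift (fun x => Comp.mk t (q x)) fun x y ⟨e, he, hl⟩ => h e he x y hl

theorem Comp.map_mk (q : G.vertexSet → K.vertexSet) (s : Finset G.edgeSet) (t : Finset K.edgeSet)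
    (h) (x : G.vertexSet) : Comp.map q s t h (Comp.mk s x) = Comp.mk t (q x) := rfl

theorem Comp.incl_mk {s t : Finset G.edgeSet} (h : s ⊆ t) (x : G.vertexSet) :
    Comp.incl G h (Comp.mk s x) = Comp.mk t x := rfl

theorem Comp.funext {X : Type*} {s : Finset G.edgeSet} {f g : Comp G s → X}
    (h : ∀ x, f (Comp.mk s x) = g (Comp.mk s x)) : f = g :=
  _root_.funext fun c => by
    obtain ⟨x, rfl⟩ := Comp.mk_surjective s c
    exact h x

theorem Comp.incl_surjective {s t : Finset G.edgeSet} (h : s ⊆ t) :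
    Function.Surjective (Comp.incl G h) := by
  intro c
  obtain ⟨x, rfl⟩ := Comp.mk_surjective t c
  exact ⟨Comp.mk s x, rfl⟩

theorem exists_isLink_vertexSet (e : G.edgeSet) : ∃ x y : G.vertexSet, G.IsLink e x y := by
  obtain ⟨x, y, h⟩ := G.exists_isLink_of_mem_edgeSet e.2
  exact ⟨⟨x, h.left_mem⟩, ⟨y, h.right_mem⟩, h⟩

/-- Two pairs of ends of the same edge agree up to order. -/
theorem isLink_cases {e : G.edgeSet} {x y u v : G.vertexSet} (h : G.IsLink e x y)
    (h' : G.IsLink e u v) : u = x ∧ v = y ∨ u = y ∧ v = x := by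
  rcases h'.eq_and_eq_or_eq_and_eq h with ⟨h1, h2⟩ | ⟨h1, h2⟩
  · exact Or.inl ⟨Subtype.ext h1, Subtype.ext h2⟩
  · exact Or.inr ⟨Subtype.ext h1, Subtype.ext h2⟩

variable [LinearOrder β]

/-- An edge whose ends are already connected does not change the components. -/
theorem Comp.incl_insert_bijective {s : Finset G.edgeSet} {e : G.edgeSet} {x y : G.vertexSet}
    (h : G.IsLink e x y) (hxy : Comp.mk s x = Comp.mk s y) :
    Function.Bijective (Comp.incl G (Finset.subset_insert e s)) := by
  refine ⟨?_, Comp.incl_surjective _⟩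
  refine Function.LeftInverse.injective (g := Comp.map id (insert e s) s ?_)
    (congrFun (Comp.funext (g := id) fun _ => rfl))
  intro g hg u v hl
  rcases Finset.mem_insert.1 hg with rfl | hg
  · rcases isLink_cases h hl with ⟨rfl, rfl⟩ | ⟨rfl, rfl⟩
    · exact hxy
    · exact hxy.symm
  · exact Comp.mk_eq_mk hg hl

variable (R : Type*) [CommRing R] (A : Type*) [CommRing A] [Algebra R A] [Finite G.vertexSet]

theorem graphDiagram_transfer {s t : Finset G.edgeSet} (h : s ⊆ t) :
    (graphDiagram R A G).transfer s t = mergeMap R A (Comp.incl G h) :=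
  CubeDiagram.transfer_of_subset _ h

theorem graphDiagram_transfer_insert_bijective {s : Finset G.edgeSet} {e : G.edgeSet}
    {x y : G.vertexSet} (h : G.IsLink e x y) (hxy : Comp.mk s x = Comp.mk s y) :
    Function.Bijective ((graphDiagram R A G).transfer s (insert e s)) := by
  rw [graphDiagram_transfer R A (Finset.subset_insert e s)]
  exact mergeMap_bijective R A (Comp.incl_insert_bijective h hxy)

/-- The cohomology of a nonempty edge set vanishes in degrees at least its rank. -/
theorem graphDiagram_exactAt_of_rank {U : Finset G.edgeSet} (hU : U.Nonempty) {k : ℕ}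
    (h : Nat.card G.vertexSet ≤ k + Nat.card (Comp G U)) : (graphDiagram R A G).ExactAt ∅ U k := by
  refine CubeDiagram.exactAt_of_rank _ (fun s => Nat.card (Comp G s)) ?_ ?_ ?_
    (Finset.empty_ssubset.2 hU) ?_
  · exact fun s t h => Nat.card_le_card_of_surjective _ (Comp.incl_surjective h)
  · intro s e
    rw [graphDiagram_transfer R A (Finset.subset_insert e s)]
    exact mergeMap_surjective R A (Comp.incl_surjective _)
  · intro S e
    -- Either `e` is a loop after contracting `S`, and remains one over every larger set, or it
    -- joins two components and lowers their number.
    obtain ⟨x, y, hl⟩ := exists_isLink_vertexSet e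
    by_cases hxy : Comp.mk S x = Comp.mk S y
    · refine Or.inl fun s hs => graphDiagram_transfer_insert_bijective R A hl ?_
      exact congrArg (Comp.incl G hs) hxy
    · right
      have hsurj := Comp.incl_surjective (G := G) (Finset.subset_insert e S)
      refine lt_of_le_of_ne (Nat.card_le_card_of_surjective _ hsurj) fun hcard => hxy ?_
      have hinj := ((Nat.bijective_iff_surjective_and_card _).2 ⟨hsurj, hcard.symm⟩).1
      exact hinj (Comp.mk_eq_mk (Finset.mem_insert_self e S) hl)
  · have := Nat.card_le_card_of_surjective _ (Comp.mk_surjective (∅ : Finset G.edgeSet))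
    rw [Finset.card_empty]
    omega

/-- Exactness is not affected by adding a pendant edge. -/
theorem graphDiagram_exactAt_of_pendant {U : Finset G.edgeSet} {e : G.edgeSet} (heU : e ∈ U)
    {x w : G.vertexSet} (hl : G.IsLink e x w) (hxw : x ≠ w)
    (hw : ∀ g ∈ U, g ≠ e → ∀ v : G.vertexSet, ¬ G.IsLink g w v) {k : ℕ}
    (h : (graphDiagram R A G).ExactAt ∅ (U.erase e) k) : (graphDiagram R A G).ExactAt ∅ U k := by
  classical
  have hw' : ∀ s : Finset G.edgeSet, s ⊆ U → e ∉ s → ∀ g ∈ s, ∀ u v : G.vertexSet,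
      G.IsLink g u v → u ≠ w ∧ v ≠ w := by
    intro s hs he g hg u v hguv
    have hge : g ≠ e := fun h => he (h ▸ hg)
    constructor
    · rintro rfl
      exact hw g (hs hg) hge v hguv
    · rintro rfl
      exact hw g (hs hg) hge u hguv.symm
  -- The section comes from retracting the pendant vertex `w` onto its neighbour `x`: the tensor
  -- factor of the merged component goes to that of `x`, and `w` receives the unit.
  have hret : ∀ s : Finset G.edgeSet, s ⊆ U ∧ e ∉ s → ∀ g ∈ insert e s, ∀ u v : G.vertexSet,
      G.IsLink g u v →
        Comp.mk s (if u = w then x else u) = Comp.mk s (if v = w then x else v) := by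
    intro s hs g hg u v hguv
    rcases Finset.mem_insert.1 hg with rfl | hg
    · rcases isLink_cases hl hguv with ⟨rfl, rfl⟩ | ⟨rfl, rfl⟩ <;> simp
    · have := hw' s hs.1 hs.2 g hg u v hguv
      rw [if_neg this.1, if_neg this.2]
      exact Comp.mk_eq_mk hg hguv
  let σ : ∀ s : Finset G.edgeSet, (⨂[R] _ : Comp G (insert e s), A) →ₗ[R] ⨂[R] _ : Comp G s, A :=
    fun s => if hs : s ⊆ U ∧ e ∉ s then
      mergeMap R A (Comp.map (fun u => if u = w then x else u) _ s (hret s hs)) else 0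
  have hσ : ∀ s (hs : s ⊆ U ∧ e ∉ s),
      σ s = mergeMap R A (Comp.map (fun u => if u = w then x else u) _ s (hret s hs)) :=
    fun s hs => dif_pos hs
  refine CubeDiagram.exactAt_of_section _ heU σ ?_ ?_ h
  · intro s hs he c
    rw [hσ s ⟨hs, he⟩, graphDiagram_transfer R A (Finset.subset_insert e s), mergeMap_mergeMap]
    refine Eq.trans ?_ (mergeMap_id R A c)
    congr 2
    refine Comp.funext fun u => ?_
    simp only [Function.comp_apply, Comp.map_mk, Comp.incl_mk, id]
    split_ifs with hu
    · rw [hu]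
      exact Comp.mk_eq_mk (Finset.mem_insert_self e s) hl
    · rfl
  · intro s t hst ht he c
    rw [hσ s ⟨hst.trans ht, fun h => he (hst h)⟩, hσ t ⟨ht, he⟩, graphDiagram_transfer R A hst,
      graphDiagram_transfer R A (Finset.insert_subset_insert e hst), mergeMap_mergeMap,
      mergeMap_mergeMap]
    congr 2
    exact Comp.funext fun _ => rfl

end Exactness

/-! ### Restriction of cochains to a subset of the edges; independence of the edge order. -/

section Pullback

variable {R : Type*} [CommRing R] {A : Type*} [CommRing A] [Algebra R A]
  {α β α' β' : Type*} [LinearOrder β] [LinearOrder β']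
  {G : Graph α β} [Finite G.vertexSet] {K : Graph α' β'} [Finite K.vertexSet]

/-- Restriction of cochains along an embedding of edges and a bijection of vertices, preserving
and reflecting incidence, induces isomorphisms in cohomology if the cochains vanishing on all sets
of embedded edges form an acyclic complex. -/
theorem hasGradedIso_of_edge_embedding (𝒜 : ℕ → Submodule R A) [GradedAlgebra 𝒜]
    (q : G.vertexSet ≃ K.vertexSet) (J : K.edgeSet ↪ G.edgeSet)
    (hlink : ∀ (e : K.edgeSet) (u v : G.vertexSet), G.IsLink (J e) u v ↔ K.IsLink e (q u) (q v))
    (τ : Finset K.edgeSet → R) (hτ : ∀ s, τ s * τ s = 1)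
    (hτJ : ∀ s, ∀ e ∈ s,
      edgeSign R e s * τ (s.erase e) = τ s * edgeSign R (J e) (s.map J))
    (hexact : ∀ k, ∀ c : TotalCochain R A G, (∀ s : Finset K.edgeSet, c (s.map J) = 0) →
      (∀ t, t.card = k + 1 → (graphDiagram R A G).d c t = 0) →
        ∃ b : TotalCochain R A G, (∀ s : Finset K.edgeSet, b (s.map J) = 0) ∧
          ∀ t, t.card = k → (graphDiagram R A G).d b t = c t) (i : ℕ) :
    HasGradedIso 𝒜 G i K i := by
  classical
  have hp : ∀ s : Finset K.edgeSet, ∀ e ∈ s.map J, ∀ u v : G.vertexSet, G.IsLink e u v →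
      Comp.mk s (q u) = Comp.mk s (q v) := by
    intro s e he u v hl
    obtain ⟨g, hg, rfl⟩ := Finset.mem_map.1 he
    exact Comp.mk_eq_mk hg ((hlink g u v).1 hl)
  let p : ∀ s : Finset K.edgeSet, Comp G (s.map J) → Comp K s := fun s => Comp.map q _ s (hp s)
  have hpb : ∀ s, Function.Bijective (p s) := by
    intro s
    refine ⟨Function.LeftInverse.injective (g := Comp.map q.symm s _ ?_)
      (congrFun (Comp.funext (g := id) fun x => ?_)), fun c => ?_⟩
    · intro e he u v hl
      refine Comp.mk_eq_mk (Finset.mem_map_of_mem J he) ((hlink e _ _).2 ?_)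
      rwa [q.apply_symm_apply, q.apply_symm_apply]
    · change Comp.mk _ (q.symm (q x)) = _
      rw [q.symm_apply_apply]
      rfl
    · obtain ⟨x, rfl⟩ := Comp.mk_surjective s c
      exact ⟨Comp.mk _ (q.symm x), by simp only [p, Comp.map_mk, q.apply_symm_apply]⟩
  let Φ : TotalCochain R A G →ₗ[R] TotalCochain R A K :=
    LinearMap.pi fun s => τ s • (mergeMap R A (p s) ∘ₗ LinearMap.proj (s.map J))
  have hΦ : ∀ c s, Φ c s = τ s • mergeMap R A (p s) (c (s.map J)) := fun _ _ => rfl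
  have hΦ0 : ∀ c s, Φ c s = 0 → c (s.map J) = 0 := by
    intro c s h
    rw [hΦ] at h
    have h1 : mergeMap R A (p s) (c (s.map J)) = 0 := by
      simpa only [smul_smul, hτ, one_smul, smul_zero] using congrArg (τ s • ·) h
    exact (mergeMap_bijective R A (hpb s)).1 (h1.trans (map_zero _).symm)
  have hd : ∀ c, (graphDiagram R A K).d (Φ c) = Φ ((graphDiagram R A G).d c) := by
    intro c
    funext s
    rw [hΦ, CubeDiagram.d_apply, CubeDiagram.d_apply, Finset.sum_map, map_sum, Finset.smul_sum]
    refine Finset.sum_congr rfl fun e he => ?_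
    rw [hΦ, map_smul, map_smul, smul_smul, smul_smul, hτJ s e he, ← Finset.map_erase,
      graphDiagram_transfer R A (Finset.erase_subset e s),
      graphDiagram_transfer R A (Finset.map_subset_map.2 (Finset.erase_subset e s)),
      mergeMap_mergeMap, mergeMap_mergeMap]
    congr 3
    exact Comp.funext fun _ => rfl
  have hlift : ∀ z, ∃ y, Φ y = z := by
    intro z
    have H : ∀ t, ∃ x : ⨂[R] _ : Comp G t, A, ∀ s : Finset K.edgeSet, s.map J = t →
        ∀ c : TotalCochain R A G, c t = x → Φ c s = z s := by
      intro t
      by_cases ht : ∃ s : Finset K.edgeSet, s.map J = t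
      · obtain ⟨s, rfl⟩ := ht
        obtain ⟨x, hx⟩ := mergeMap_surjective R A (hpb s).2 (τ s • z s)
        refine ⟨x, fun s' hs' c hc => ?_⟩
        obtain rfl := Finset.map_injective J hs'
        rw [hΦ, hc, hx, smul_smul, hτ, one_smul]
      · exact ⟨0, fun s hs => (ht ⟨s, hs⟩).elim⟩
    choose y hy using H
    exact ⟨y, funext fun s => hy _ s rfl y rfl⟩
  have key := exists_cohomology_map 𝒜 Φ i 0 hd ?_ ?_ ?_
  · refine key.2 ?_
    rintro y hy ⟨b, hb⟩
    obtain ⟨b₁, rfl⟩ := hlift b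
    obtain ⟨b₂, -, hb₂⟩ := hexact i
      (fun t => if t.card = i then (y - (graphDiagram R A G).d b₁) t else 0) (by
        intro s
        split_ifs with hs
        · rw [Finset.card_map] at hs
          apply hΦ0
          rw [map_sub, Pi.sub_apply, hb s hs, hd, sub_self]
        · rfl) (by
        intro t ht
        rw [CubeDiagram.d_congr_of_card (c' := y - (graphDiagram R A G).d b₁) _
          fun s hs => if_pos (by omega), map_sub, CubeDiagram.d_d, sub_zero, hy t ht])
    refine ⟨b₁ + b₂, fun s hs => ?_⟩
    rw [map_add, Pi.add_apply, hb₂ s hs, if_pos hs, Pi.sub_apply, add_sub_cancel]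
  · intro c t h
    rw [hΦ, h _ (by simp), map_zero, smul_zero]
  · intro j c
    funext s
    rw [hΦ, cochainProj_apply, cochainProj_apply, hΦ, map_smul, tensorProj_mergeMap]
  · intro z hz
    obtain ⟨y, rfl⟩ := hlift z
    rw [hd] at hz
    -- The lift `y` need not be closed, but its differential restricts to zero; acyclicity of the
    -- kernel supplies a correction that does not change the restriction.
    obtain ⟨b, hb, hbd⟩ := hexact (i + 1) ((graphDiagram R A G).d y)
      (fun s => hΦ0 _ s (congrFun hz s)) fun t _ => by rw [CubeDiagram.d_d]; rfl
    refine ⟨y - b, 0, fun s hs => ?_, fun t _ => ?_⟩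
    · rw [map_sub, Pi.sub_apply, hbd s hs, sub_self]
    · rw [map_sub, Pi.sub_apply, sub_sub_cancel, hΦ, hb, map_zero, smul_zero, map_zero]
      rfl

variable (R) in
theorem exists_inversion_sign {E E' : Type*} [LinearOrder E] [LinearOrder E'] (J : E' ↪ E) :
    ∃ τ : Finset E' → R, (∀ s, τ s * τ s = 1) ∧ ∀ s, ∀ e ∈ s,
      edgeSign R e s * τ (s.erase e) = τ s * edgeSign R (J e) (s.map J) := by
  -- `κ e g` is `-1` exactly on inversions of `J`, each counted for one ordering of the pair, so the
  -- product over a set is `(-1)` to its number of inversions.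
  let κ : E' → E' → R := fun e g => if g < e ∧ J e < J g then -1 else 1
  have hκ : ∀ e g, κ e g * κ e g = 1 := fun e g => by
    dsimp only [κ]
    split_ifs <;> simp
  have hκ1 : ∀ e, κ e e = 1 := fun e => by simp [κ]
  have hκκ : ∀ e g, e ≠ g → κ e g * κ g e *
      (if J g < J e then (-1 : R) else 1) = if g < e then (-1 : R) else 1 := by
    intro e g hne
    rcases lt_or_gt_of_ne hne with h | h <;>
      rcases lt_or_gt_of_ne (J.injective.ne hne) with h' | h' <;>
      simp [κ, h, h.not_gt, h', h'.not_gt]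
  refine ⟨fun s => ∏ e ∈ s, ∏ g ∈ s, κ e g, fun s => ?_, fun t e he => ?_⟩
  · simp only [← Finset.prod_mul_distrib, hκ, Finset.prod_const_one]
  · dsimp only
    obtain ⟨s, hs, rfl⟩ : ∃ s, e ∉ s ∧ t = insert e s :=
      ⟨t.erase e, by simp, (Finset.insert_erase he).symm⟩
    have hne : ∀ g ∈ s, e ≠ g := fun g hg h => hs (h ▸ hg)
    rw [Finset.erase_insert hs, edgeSign_insert_self, Finset.map_insert, edgeSign_insert_self,
      edgeSign_eq_prod, edgeSign_eq_prod, Finset.prod_map, Finset.prod_insert hs,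
      Finset.prod_insert hs, hκ1, one_mul]
    simp only [Finset.prod_insert hs, Finset.prod_mul_distrib]
    rw [← Finset.prod_congr rfl fun g hg => hκκ e g (hne g hg), Finset.prod_mul_distrib,
      Finset.prod_mul_distrib]
    ring

theorem IsIsomorphic.hasGradedIso (𝒜 : ℕ → Submodule R A) [GradedAlgebra 𝒜]
    (h : IsIsomorphic G K) (i : ℕ) : HasGradedIso 𝒜 G i K i := by
  obtain ⟨φ, ψ, h⟩ := h
  obtain ⟨τ, hτ, hτJ⟩ := exists_inversion_sign R ψ.symm.toEmbedding
  refine hasGradedIso_of_edge_embedding 𝒜 φ ψ.symm.toEmbedding ?_ τ hτ hτJ ?_ i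
  · intro e u v
    rw [h]
    simp
  · intro k c hc _
    have : c = 0 := by
      funext t
      have ht : (t.map ψ.toEmbedding).map ψ.symm.toEmbedding = t := by
        ext g
        simp
      have := hc (t.map ψ.toEmbedding)
      rwa [ht] at this
    exact ⟨0, fun _ => rfl, fun t _ => by rw [this, map_zero]⟩

end Pullback

/-! ### Doubling an edge does not change cohomology. -/

section Doubling

variable {R : Type*} [CommRing R] {A : Type*} [CommRing A] [Algebra R A]
  {α β : Type*} {G K : Graph α β}

theorem IsDoubling.edgeSet_eq (h : IsDoubling G K) :
    ∃ f ∉ G.edgeSet, K.edgeSet = insert f G.edgeSet := by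
  obtain ⟨e, he, f, hf, -, hl⟩ := h
  refine ⟨f, hf, Set.ext fun g => ?_⟩
  obtain ⟨x, y, hxy⟩ := G.exists_isLink_of_mem_edgeSet he
  rw [K.edge_mem_iff_exists_isLink, Set.mem_insert_iff, G.edge_mem_iff_exists_isLink]
  constructor
  · rintro ⟨u, v, huv⟩
    rcases (hl g u v).1 huv with h | h
    · exact Or.inr ⟨u, v, h⟩
    · exact Or.inl h.1
  · rintro (rfl | ⟨u, v, huv⟩)
    · exact ⟨x, y, (hl _ _ _).2 (Or.inr ⟨rfl, hxy⟩)⟩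
    · exact ⟨u, v, (hl _ _ _).2 (Or.inl huv)⟩

variable [LinearOrder β] [Finite G.vertexSet] [Finite K.vertexSet]

theorem IsDoubling.hasGradedIso (𝒜 : ℕ → Submodule R A) [GradedAlgebra 𝒜] [Finite K.edgeSet]
    (h : IsDoubling G K) (i : ℕ) : HasGradedIso 𝒜 G i K i := by
  have : Fintype K.edgeSet := Fintype.ofFinite _
  obtain ⟨f', hf', hKE⟩ := h.edgeSet_eq
  obtain ⟨e, he, f, hf, hV, hl⟩ := h
  have hfe : f ∈ K.edgeSet := by
    obtain ⟨x, y, hxy⟩ := G.exists_isLink_of_mem_edgeSet he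
    exact ((hl f x y).2 (Or.inr ⟨rfl, hxy⟩)).edge_mem
  obtain rfl : f' = f := by
    rw [hKE] at hfe
    exact (hfe.resolve_right hf).symm
  have hGK : G.edgeSet ⊆ K.edgeSet := hKE ▸ Set.subset_insert _ _
  let J : G.edgeSet ↪ K.edgeSet := ⟨fun g => ⟨g.1, hGK g.2⟩, fun a b h =>
    Subtype.ext (congrArg (fun z : K.edgeSet => z.1) h)⟩
  let f : K.edgeSet := ⟨f', hfe⟩
  have hJf : ∀ g, J g ≠ f := fun g h => by
    have hg : g.1 = f' := congrArg (fun z : K.edgeSet => z.1) h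
    exact hf' (hg ▸ g.2)
  have hfJ : ∀ t : Finset K.edgeSet, f ∉ t → ∃ s : Finset G.edgeSet, s.map J = t := by
    intro t ht
    refine ⟨t.preimage J J.injective.injOn, ?_⟩
    ext g
    simp only [Finset.mem_map, Finset.mem_preimage]
    constructor
    · rintro ⟨a, ha, rfl⟩
      exact ha
    · intro hg
      have hg' : g.1 ∈ G.edgeSet := by
        have hg2 : g.1 ∈ insert f' G.edgeSet := hKE ▸ g.2
        exact hg2.resolve_left fun h => ht ((Subtype.ext h : g = f) ▸ hg)
      exact ⟨⟨g.1, hg'⟩, hg, rfl⟩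
  refine HasGradedIso.symm (hasGradedIso_of_edge_embedding 𝒜 (Equiv.setCongr hV) J ?_
    (fun _ => 1) (fun _ => one_mul 1) ?_ ?_ i)
  · rintro ⟨g, hg⟩ u v
    refine (hl g u v).trans (or_iff_left fun h => hf' (h.1 ▸ hg))
  · intro s g _
    rw [one_mul, mul_one, edgeSign_eq_prod, edgeSign_eq_prod, Finset.prod_map]
    rfl
  · intro k c hc hdc
    obtain ⟨x, y, hxy⟩ := exists_isLink_vertexSet (⟨e, he⟩ : G.edgeSet)
    let x' : K.vertexSet := ⟨x.1, hV.symm ▸ x.2⟩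
    let y' : K.vertexSet := ⟨y.1, hV.symm ▸ y.2⟩
    have hJe : K.IsLink (J ⟨e, he⟩) x' y' := (hl _ _ _).2 (Or.inl hxy)
    have hfl : K.IsLink f x' y' := (hl _ _ _).2 (Or.inr ⟨rfl, hxy⟩)
    -- The kernel of restriction consists of cochains on sets containing `f`, where the edge
    -- parallel to `f` acts as a loop.
    have hex : (graphDiagram R A K).ExactAt {f} Finset.univ k := by
      refine CubeDiagram.exactAt_of_bijective _ (e := J ⟨e, he⟩)
        (by simpa using hJf _) (Finset.mem_univ _) (fun s hs _ _ => ?_) k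
      exact graphDiagram_transfer_insert_bijective R A hJe
        (Comp.mk_eq_mk (hs (Finset.mem_singleton_self f)) hfl)
    obtain ⟨b, hb, hbc⟩ := hex c (fun t ht => by
      obtain ⟨s, rfl⟩ := hfJ t (by simpa using ht)
      exact hc s) fun t _ => hdc t
    refine ⟨b, fun s => hb _ ?_, fun t => hbc t (Finset.subset_univ t)⟩
    rw [Finset.singleton_subset_iff, Finset.mem_map]
    rintro ⟨g, -, hg⟩
    exact hJf g hg

end Doubling

/-! ### The deletion-contraction sequence of a subdivided edge. -/

section Subdivision

variable {R : Type*} [CommRing R] {A : Type*} [CommRing A] [Algebra R A]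
  {α β α' β' : Type*} [LinearOrder β] [LinearOrder β'] {G : Graph α β} {K : Graph α' β'}

/-- A presentation of `K` as the graph obtained from `G` by subdividing the edge `e` with ends `x`,
`y` into an edge `e` from `x` to a new vertex `w` and a new edge `f` from `w` to `y`. -/
structure SubdivisionData (G : Graph α β) (K : Graph α' β') where
  edgeEmb : G.edgeSet ↪o K.edgeSet
  vertexEmb : G.vertexSet ↪ K.vertexSet
  e : G.edgeSet
  f : K.edgeSet
  x : G.vertexSet
  y : G.vertexSet
  w : K.vertexSet
  exists_edgeEmb : ∀ g, g ≠ f → ∃ g', edgeEmb g' = g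
  edgeEmb_ne : ∀ g, edgeEmb g ≠ f
  exists_vertexEmb : ∀ v, v ≠ w → ∃ v', vertexEmb v' = v
  vertexEmb_ne : ∀ v, vertexEmb v ≠ w
  isLink_of_ne : ∀ g, g ≠ e → ∀ u v : G.vertexSet, G.IsLink g u v →
    K.IsLink (edgeEmb g) (vertexEmb u) (vertexEmb v)
  isLink_e : G.IsLink e x y
  isLink_edgeEmb_e : K.IsLink (edgeEmb e) (vertexEmb x) w
  isLink_f : K.IsLink f w (vertexEmb y)

namespace SubdivisionData

variable (S : SubdivisionData G K)

/-- The set of the edges of `G` corresponding to a set of edges of `K`. -/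
def pre (t : Finset K.edgeSet) : Finset G.edgeSet :=
  t.preimage S.edgeEmb S.edgeEmb.injective.injOn

theorem mem_pre {t : Finset K.edgeSet} {g : G.edgeSet} : g ∈ S.pre t ↔ S.edgeEmb g ∈ t :=
  Finset.mem_preimage

theorem pre_erase (t : Finset K.edgeSet) (g : G.edgeSet) :
    S.pre (t.erase (S.edgeEmb g)) = (S.pre t).erase g := by
  ext a
  simp [mem_pre]

theorem insert_map_pre {t : Finset K.edgeSet} (ht : S.f ∈ t) :
    insert S.f ((S.pre t).map S.edgeEmb.toEmbedding) = t := by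
  ext g
  simp only [Finset.mem_insert, Finset.mem_map, mem_pre]
  constructor
  · rintro (rfl | ⟨a, ha, rfl⟩)
    · exact ht
    · exact ha
  · intro hg
    by_cases hgf : g = S.f
    · exact Or.inl hgf
    · obtain ⟨a, rfl⟩ := S.exists_edgeEmb g hgf
      exact Or.inr ⟨a, hg, rfl⟩

theorem pre_insert_map (s : Finset G.edgeSet) :
    S.pre (insert S.f (s.map S.edgeEmb.toEmbedding)) = s := by
  ext g
  simp [mem_pre, S.edgeEmb_ne]

theorem f_notMem_map (s : Finset G.edgeSet) : S.f ∉ s.map S.edgeEmb.toEmbedding := by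
  intro h
  obtain ⟨g, -, hg⟩ := Finset.mem_map.1 h
  exact S.edgeEmb_ne g hg

theorem card_pre {t : Finset K.edgeSet} (ht : S.f ∈ t) : (S.pre t).card + 1 = t.card := by
  conv_rhs => rw [← S.insert_map_pre ht]
  rw [Finset.card_insert_of_notMem (S.f_notMem_map _), Finset.card_map]

theorem pre_injOn {t t' : Finset K.edgeSet} (ht : S.f ∈ t) (ht' : S.f ∈ t')
    (h : S.pre t = S.pre t') : t = t' := by
  rw [← S.insert_map_pre ht, ← S.insert_map_pre ht', h]

theorem mk_vertexEmb_eq {t : Finset K.edgeSet} (ht : S.f ∈ t) :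
    ∀ g ∈ S.pre t, ∀ u v : G.vertexSet, G.IsLink g u v →
      Comp.mk t (S.vertexEmb u) = Comp.mk t (S.vertexEmb v) := by
  intro g hg u v hl
  rw [mem_pre] at hg
  by_cases hge : g = S.e
  · subst hge
    have hxy : Comp.mk t (S.vertexEmb S.x) = Comp.mk t (S.vertexEmb S.y) :=
      (Comp.mk_eq_mk hg S.isLink_edgeEmb_e).trans (Comp.mk_eq_mk ht S.isLink_f)
    rcases isLink_cases S.isLink_e hl with ⟨rfl, rfl⟩ | ⟨rfl, rfl⟩
    · exact hxy
    · exact hxy.symm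
  · exact Comp.mk_eq_mk hg (S.isLink_of_ne g hge u v hl)

/-- The map on components induced by the inclusion of vertices. -/
def compMap (t : Finset K.edgeSet) (ht : S.f ∈ t) : Comp G (S.pre t) → Comp K t :=
  Comp.map S.vertexEmb _ _ (S.mk_vertexEmb_eq ht)

theorem compMap_bijective (t : Finset K.edgeSet) (ht : S.f ∈ t) :
    Function.Bijective (S.compMap t ht) := by
  -- The inverse collapses `f`: it sends the new vertex `w` to `y` and every old vertex to itself.
  have H : ∀ v, ∃ u, (∀ u', S.vertexEmb u' = v → u = u') ∧ (v = S.w → u = S.y) := by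
    intro v
    by_cases hv : v = S.w
    · exact ⟨S.y, fun u' hu => (S.vertexEmb_ne u' (hu.trans hv)).elim, fun _ => rfl⟩
    · obtain ⟨u, rfl⟩ := S.exists_vertexEmb v hv
      exact ⟨u, fun u' hu => S.vertexEmb.injective hu.symm, fun h => (hv h).elim⟩
  choose ρ hρ hρw using H
  have hρe : ∀ u, ρ (S.vertexEmb u) = u := fun u => hρ _ u rfl
  constructor
  · refine Function.LeftInverse.injective (g := Comp.map ρ t (S.pre t) ?_)
      (congrFun (Comp.funext (g := id) fun u => ?_))
    · intro g hg u v hl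
      by_cases hgf : g = S.f
      · subst hgf
        rcases isLink_cases S.isLink_f hl with ⟨rfl, rfl⟩ | ⟨rfl, rfl⟩ <;>
          rw [hρw _ rfl, hρe]
      obtain ⟨g, rfl⟩ := S.exists_edgeEmb g hgf
      have hg' : g ∈ S.pre t := S.mem_pre.2 hg
      by_cases hge : g = S.e
      · subst hge
        have hxy : Comp.mk (S.pre t) S.x = Comp.mk (S.pre t) S.y := Comp.mk_eq_mk hg' S.isLink_e
        rcases isLink_cases S.isLink_edgeEmb_e hl with ⟨rfl, rfl⟩ | ⟨rfl, rfl⟩ <;>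
          rw [hρw _ rfl, hρe, hxy]
      · obtain ⟨a, b, hab⟩ := exists_isLink_vertexSet g
        have h := Comp.mk_eq_mk hg' hab
        rcases isLink_cases (S.isLink_of_ne g hge a b hab) hl with ⟨rfl, rfl⟩ | ⟨rfl, rfl⟩ <;>
          rw [hρe, hρe, h]
    · exact congrArg (Comp.mk _) (hρe u)
  · intro c
    obtain ⟨v, rfl⟩ := Comp.mk_surjective t c
    by_cases hv : v = S.w
    · exact ⟨Comp.mk _ S.y, hv ▸ (Comp.mk_eq_mk ht S.isLink_f).symm⟩
    · obtain ⟨u, rfl⟩ := S.exists_vertexEmb v hv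
      exact ⟨Comp.mk _ u, rfl⟩

variable (R) in
/-- The sign comparing the differentials of `G` and `K`. -/
def sign (s : Finset G.edgeSet) : R := ∏ g ∈ s, if S.f < S.edgeEmb g then -1 else 1

theorem sign_mul_self (s : Finset G.edgeSet) : S.sign R s * S.sign R s = 1 := by
  rw [sign, ← Finset.prod_mul_distrib]
  refine Finset.prod_eq_one fun g _ => ?_
  split_ifs <;> simp

/-- Since `edgeEmb` preserves the order, the signs differ only because `f` is counted among the
edges before `g`; `sign` absorbs this. -/
theorem edgeSign_mul_sign {t : Finset K.edgeSet} (ht : S.f ∈ t) {g : G.edgeSet}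
    (hg : g ∈ S.pre t) :
    edgeSign R (S.edgeEmb g) t * S.sign R ((S.pre t).erase g) =
      S.sign R (S.pre t) * edgeSign R g (S.pre t) := by
  have h1 : edgeSign R (S.edgeEmb g) t =
      (if S.f < S.edgeEmb g then -1 else 1) * edgeSign R g (S.pre t) := by
    conv_lhs => rw [← S.insert_map_pre ht]
    rw [edgeSign_insert (S.f_notMem_map _), edgeSign_eq_prod, edgeSign_eq_prod, Finset.prod_map]
    simp
  have h2 : S.sign R (S.pre t) =
      (if S.f < S.edgeEmb g then -1 else 1) * S.sign R ((S.pre t).erase g) :=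
    (Finset.mul_prod_erase _ _ hg).symm
  rw [h1, h2]
  ring

variable [Finite G.vertexSet]

variable (R A) in
/-- The embedding of the cochains of `G` onto the cochains of `K` that are supported on the edge
sets containing `f`. -/
def push : TotalCochain R A G →ₗ[R] TotalCochain R A K :=
  LinearMap.pi fun t => if ht : S.f ∈ t then
    S.sign R (S.pre t) • (mergeMap R A (S.compMap t ht) ∘ₗ LinearMap.proj (S.pre t)) else 0

theorem push_apply (c : TotalCochain R A G) {t : Finset K.edgeSet} (ht : S.f ∈ t) :
    S.push R A c t = S.sign R (S.pre t) • mergeMap R A (S.compMap t ht) (c (S.pre t)) := by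
  simp only [push, LinearMap.pi_apply, dif_pos ht]
  rfl

theorem push_apply_of_notMem (c : TotalCochain R A G) {t : Finset K.edgeSet} (ht : S.f ∉ t) :
    S.push R A c t = 0 := by
  simp only [push, LinearMap.pi_apply, dif_neg ht]
  rfl

variable [Finite K.vertexSet]

theorem eq_zero_of_push_eq_zero {c : TotalCochain R A G} {s : Finset G.edgeSet}
    (h : S.push R A c (insert S.f (s.map S.edgeEmb.toEmbedding)) = 0) : c s = 0 := by
  have ht := Finset.mem_insert_self S.f (s.map S.edgeEmb.toEmbedding)
  rw [S.push_apply c ht] at h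
  have h1 := congrArg (S.sign R (S.pre (insert S.f (s.map S.edgeEmb.toEmbedding))) • ·) h
  simp only [smul_smul, sign_mul_self, one_smul, smul_zero] at h1
  have h2 := (mergeMap_bijective R A (S.compMap_bijective _ ht)).1 (h1.trans (map_zero _).symm)
  rwa [S.pre_insert_map] at h2

theorem exists_push_eq {c : TotalCochain R A K} (hc : ∀ t, S.f ∉ t → c t = 0) :
    ∃ y, S.push R A y = c := by
  have H : ∀ s, ∃ x : ⨂[R] _ : Comp G s, A, ∀ t, S.f ∈ t → S.pre t = s →
      ∀ y : TotalCochain R A G, y s = x → S.push R A y t = c t := by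
    intro s
    obtain ⟨t, ht, rfl⟩ : ∃ t, S.f ∈ t ∧ S.pre t = s :=
      ⟨_, Finset.mem_insert_self _ _, S.pre_insert_map s⟩
    obtain ⟨x, hx⟩ := mergeMap_surjective R A (S.compMap_bijective t ht).2
      (S.sign R (S.pre t) • c t)
    refine ⟨x, fun t' ht' h y hy => ?_⟩
    obtain rfl := S.pre_injOn ht' ht h
    rw [S.push_apply y ht, hy, hx, smul_smul, sign_mul_self, one_smul]
  choose y hy using H
  refine ⟨y, funext fun t => ?_⟩
  by_cases ht : S.f ∈ t
  · exact hy _ t ht rfl y rfl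
  · rw [S.push_apply_of_notMem y ht, hc t ht]

theorem d_push (c : TotalCochain R A G) :
    (graphDiagram R A K).d (S.push R A c) = S.push R A ((graphDiagram R A G).d c) := by
  funext t
  by_cases ht : S.f ∈ t
  · rw [S.push_apply _ ht, CubeDiagram.d_apply, CubeDiagram.d_apply,
      ← Finset.sum_preimage S.edgeEmb t S.edgeEmb.injective.injOn, map_sum, Finset.smul_sum]
    · refine Finset.sum_congr rfl fun g hg => ?_
      have ht' : S.f ∈ t.erase (S.edgeEmb g) :=
        Finset.mem_erase.2 ⟨(S.edgeEmb_ne g).symm, ht⟩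
      -- The set `S.pre (t.erase (S.edgeEmb g))` equals `(S.pre t).erase g` only propositionally and
      -- tensor powers depend on it, so the identity is stated for a free `s` and the equation
      -- substituted.
      have key : ∀ s (hs : s = (S.pre t).erase g) (hs' : s ⊆ S.pre t)
          (p : Comp G s → Comp K (t.erase (S.edgeEmb g))),
          Comp.incl K (Finset.erase_subset (S.edgeEmb g) t) ∘ p =
            S.compMap t ht ∘ Comp.incl G hs' →
          edgeSign R (S.edgeEmb g) t • mergeMap R A (Comp.incl K (Finset.erase_subset _ t))
            (S.sign R s • mergeMap R A p (c s)) =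
          S.sign R (S.pre t) • mergeMap R A (S.compMap t ht) (edgeSign R g (S.pre t) •
            (graphDiagram R A G).transfer ((S.pre t).erase g) (S.pre t)
              (c ((S.pre t).erase g))) := by
        rintro s rfl hs' p hp
        rw [map_smul, map_smul, smul_smul, smul_smul, S.edgeSign_mul_sign ht hg,
          graphDiagram_transfer R A hs', mergeMap_mergeMap, mergeMap_mergeMap, hp]
      rw [S.push_apply c ht', graphDiagram_transfer R A (Finset.erase_subset (S.edgeEmb g) t)]
      refine key _ (S.pre_erase t g) (S.pre_erase t g ▸ Finset.erase_subset _ _) _ ?_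
      exact Comp.funext fun _ => rfl
    · intro g _ hg
      have hgf : g = S.f := by
        by_contra h
        exact hg (S.exists_edgeEmb g h)
      rw [S.push_apply_of_notMem c (by simp [hgf]), map_zero, smul_zero]
  · rw [S.push_apply_of_notMem _ ht, CubeDiagram.d_congr (c' := 0), map_zero]
    · rfl
    · exact fun g _ => S.push_apply_of_notMem c fun h => ht (Finset.mem_of_mem_erase h)

/-- Subdividing an edge induces a graded epimorphism in cohomology if the complex of the subdivided
graph without `f` is exact in degree `i + 1`, and an isomorphism if it is exact in degree `i`
as well. -/
theorem exists_cohomology_map_of_exactAt (𝒜 : ℕ → Submodule R A) [GradedAlgebra 𝒜] (i : ℕ)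
    (U : Finset K.edgeSet) (hfU : S.f ∉ U)
    (hex : (graphDiagram R A K).ExactAt ∅ U (i + 1)) (hU : ∀ g, g ≠ S.f → g ∈ U) :
    HasGradedEpi 𝒜 G i K (i + 1) ∧
      ((graphDiagram R A K).ExactAt ∅ U i → HasGradedIso 𝒜 G i K (i + 1)) := by
  classical
  have hsub : ∀ t : Finset K.edgeSet, S.f ∉ t → t ⊆ U :=
    fun t ht g hg => hU g fun h => ht (h ▸ hg)
  have hsub' : ∀ t : Finset K.edgeSet, t ⊆ U → S.f ∉ t := fun t ht h => hfU (ht h)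
  have hdy : ∀ (y : TotalCochain R A G) (k : ℕ),
      (∀ t : Finset K.edgeSet, t.card = k + 1 → (graphDiagram R A K).d (S.push R A y) t = 0) →
        ∀ s : Finset G.edgeSet, s.card = k → (graphDiagram R A G).d y s = 0 := by
    intro y k h s hs
    refine S.eq_zero_of_push_eq_zero ?_
    rw [← d_push]
    refine h _ ?_
    rw [Finset.card_insert_of_notMem (S.f_notMem_map _), Finset.card_map, hs]
  have key := exists_cohomology_map 𝒜 (S.push R A) i 1 S.d_push ?_ ?_ ?_
  · refine ⟨key.1, fun hex' => key.2 ?_⟩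
    rintro y hy ⟨b, hb⟩
    -- The primitive `b` is closed on `K - f`, because pushed cochains vanish there. Exactness in
    -- degree `i` makes it a coboundary; after subtraction the primitive comes from `G`.
    obtain ⟨a, -, ha⟩ := hex' b (CubeDiagram.supportedAbove_empty b) fun t ht hk => by
      rw [← hb t hk, S.push_apply_of_notMem y (hsub' t ht)]
    obtain ⟨y', hy'⟩ := S.exists_push_eq
      (c := fun t => if S.f ∈ t then (b - (graphDiagram R A K).d a) t else 0)
      fun t ht => if_neg ht
    refine ⟨y', fun s hs => ?_⟩
    rw [← sub_eq_zero, ← Pi.sub_apply]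
    refine S.eq_zero_of_push_eq_zero ?_
    have hcard : (insert S.f (s.map S.edgeEmb.toEmbedding)).card = i + 1 := by
      rw [Finset.card_insert_of_notMem (S.f_notMem_map _), Finset.card_map, hs]
    rw [map_sub, Pi.sub_apply, hb _ hcard, ← d_push, hy', sub_eq_zero]
    trans (graphDiagram R A K).d (b - (graphDiagram R A K).d a)
        (insert S.f (s.map S.edgeEmb.toEmbedding))
    · rw [map_sub, CubeDiagram.d_d, sub_zero]
    refine CubeDiagram.d_congr_of_card _ fun t ht => ?_
    split_ifs with hft
    · rfl
    · rw [Pi.sub_apply, ha t (hsub t hft) (by omega), sub_self]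
  · intro c t h
    by_cases ht : S.f ∈ t
    · rw [S.push_apply c ht, h _ (S.card_pre ht), map_zero, smul_zero]
    · exact S.push_apply_of_notMem c ht
  · intro j c
    funext t
    rw [cochainProj_apply]
    by_cases ht : S.f ∈ t
    · rw [S.push_apply _ ht, S.push_apply _ ht, cochainProj_apply, map_smul, tensorProj_mergeMap]
    · rw [S.push_apply_of_notMem _ ht, S.push_apply_of_notMem _ ht, map_zero]
  · intro z hz
    -- The cocycle is made zero on sets avoiding `f` by subtracting a coboundary; what is left is
    -- pushed forward from `G`.
    obtain ⟨b, -, hb⟩ := hex z (CubeDiagram.supportedAbove_empty z) fun t _ _ => congrFun hz t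
    obtain ⟨y, hy⟩ := S.exists_push_eq
      (c := fun t => if S.f ∈ t then (z - (graphDiagram R A K).d b) t else 0)
      fun t ht => if_neg ht
    have hzy : ∀ t : Finset K.edgeSet, t.card = i + 1 →
        S.push R A y t = (z - (graphDiagram R A K).d b) t := by
      intro t ht
      rw [hy]
      dsimp only
      split_ifs with hft
      · rfl
      · rw [Pi.sub_apply, hb t (hsub t hft) ht, sub_self]
    refine ⟨y, b, hdy y (i + 1) fun t ht => ?_, fun t ht => ?_⟩
    · rw [CubeDiagram.d_congr_of_card (c' := z - (graphDiagram R A K).d b) _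
        fun s hs => hzy s (by omega), map_sub, CubeDiagram.d_d, sub_zero, hz]
      rfl
    · rw [hzy t ht, Pi.sub_apply, sub_sub_cancel]

end SubdivisionData

end Subdivision

/-! ### Subdivisions in the critical degree, polygons, and the induction over operations. -/

section SeriesParallel

variable {R : Type*} [CommRing R] {A : Type*} [CommRing A] [Algebra R A]

namespace SubdivisionData

variable {α β α' β' : Type*} [LinearOrder β] [LinearOrder β'] {G : Graph α β} {K : Graph α' β'}
  (S : SubdivisionData G K)

theorem card_vertexSet (S : SubdivisionData G K) [Finite G.vertexSet] :
    Nat.card K.vertexSet = Nat.card G.vertexSet + 1 := by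
  rw [← Finite.card_option]
  refine (Nat.card_eq_of_bijective (fun u : Option G.vertexSet => u.elim S.w S.vertexEmb)
    ⟨?_, fun v => ?_⟩).symm
  · rintro (_ | u) (_ | v) h
    · rfl
    · exact (S.vertexEmb_ne v h.symm).elim
    · exact (S.vertexEmb_ne u h).elim
    · exact congrArg some (S.vertexEmb.injective h)
  · by_cases hv : v = S.w
    · exact ⟨none, hv.symm⟩
    · obtain ⟨u, rfl⟩ := S.exists_vertexEmb v hv
      exact ⟨some u, rfl⟩

theorem ne_w_of_isLink {g : K.edgeSet} (hgf : g ≠ S.f) (hge : g ≠ S.edgeEmb S.e)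
    {u v : K.vertexSet} (h : K.IsLink g u v) : u ≠ S.w := by
  obtain ⟨g, rfl⟩ := S.exists_edgeEmb g hgf
  obtain ⟨a, b, hab⟩ := exists_isLink_vertexSet g
  rcases isLink_cases (S.isLink_of_ne g (fun h => hge (h ▸ rfl)) a b hab) h with
    ⟨rfl, rfl⟩ | ⟨rfl, rfl⟩ <;> exact S.vertexEmb_ne _

/-- The second edge required by `hE` keeps the edge set nonempty once `f` and the other half of `e`
are removed; the rank bound needs this. -/
theorem hasGradedEpi (𝒜 : ℕ → Submodule R A) [GradedAlgebra 𝒜] [Finite G.vertexSet]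
    [Finite K.vertexSet] [Finite K.edgeSet] (hE : ∃ g, g ≠ S.e) {i : ℕ}
    (hi : Nat.card G.vertexSet ≤ i + 2) : HasGradedEpi 𝒜 G i K (i + 1) := by
  have : Fintype K.edgeSet := Fintype.ofFinite _
  refine (S.exists_cohomology_map_of_exactAt 𝒜 i (Finset.univ.erase S.f)
    (Finset.notMem_erase _ _) ?_
    fun g hg => Finset.mem_erase.2 ⟨hg, Finset.mem_univ g⟩).1
  refine graphDiagram_exactAt_of_pendant R A
    (Finset.mem_erase.2 ⟨S.edgeEmb_ne S.e, Finset.mem_univ _⟩)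
    S.isLink_edgeEmb_e (S.vertexEmb_ne _)
    (fun g hg hge v hl => S.ne_w_of_isLink (Finset.ne_of_mem_erase hg) hge hl rfl) ?_
  set U := (Finset.univ.erase S.f).erase (S.edgeEmb S.e)
  refine graphDiagram_exactAt_of_rank R A ?_ ?_
  · obtain ⟨g, hg⟩ := hE
    exact ⟨S.edgeEmb g, Finset.mem_erase.2 ⟨S.edgeEmb.injective.ne hg,
      Finset.mem_erase.2 ⟨S.edgeEmb_ne g, Finset.mem_univ _⟩⟩⟩
  · have h2 : 1 < Nat.card (Comp K U) := by
      refine Finite.one_lt_card_iff_nontrivial.2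
        ⟨Comp.mk U S.w, Comp.mk U (S.vertexEmb S.x), fun h => ?_⟩
      let P : Comp K U → Prop := Quot.lift (fun v => v = S.w) fun u v ⟨g, hg, hl⟩ => by
        have hge := Finset.ne_of_mem_erase hg
        have hgf := Finset.ne_of_mem_erase (Finset.mem_of_mem_erase hg)
        exact propext ⟨fun h => (S.ne_w_of_isLink hgf hge hl h).elim,
          fun h => (S.ne_w_of_isLink hgf hge hl.symm h).elim⟩
      have hP : P (Comp.mk U (S.vertexEmb S.x)) := h ▸ (rfl : S.w = S.w)
      exact S.vertexEmb_ne _ hP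
    rw [S.card_vertexSet]
    omega

end SubdivisionData

section

variable {α β : Type*} {G K : Graph α β}

theorem IsSubdivision.edgeSet_eq (h : IsSubdivision G K) :
    ∃ f ∉ G.edgeSet, K.edgeSet = insert f G.edgeSet := by
  obtain ⟨e, x, y, hxy, f, hf, w, hw, -, hl⟩ := h
  refine ⟨f, hf, Set.ext fun g => ?_⟩
  rw [K.edge_mem_iff_exists_isLink, Set.mem_insert_iff]
  constructor
  · rintro ⟨u, v, huv⟩
    rcases (hl g u v).1 huv with h | h | h
    · exact Or.inr h.2.edge_mem
    · exact Or.inr (h.1 ▸ hxy.edge_mem)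
    · exact Or.inl h.1
  · rintro (rfl | hg)
    · exact ⟨w, y, (hl _ _ _).2 (Or.inr (Or.inr ⟨rfl, rfl⟩))⟩
    · by_cases hge : g = e
      · exact ⟨x, w, (hl _ _ _).2 (Or.inr (Or.inl ⟨hge, rfl⟩))⟩
      · obtain ⟨u, v, huv⟩ := G.exists_isLink_of_mem_edgeSet hg
        exact ⟨u, v, (hl _ _ _).2 (Or.inl ⟨hge, huv⟩)⟩

theorem IsSubdivision.nonempty_subdivisionData [LinearOrder β] (h : IsSubdivision G K) :
    Nonempty (SubdivisionData G K) := by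
  obtain ⟨f', hf', hKE⟩ := h.edgeSet_eq
  obtain ⟨e, x, y, hxy, f, hf, w, hw, hV, hl⟩ := h
  have hfl : K.IsLink f w y := (hl _ _ _).2 (Or.inr (Or.inr ⟨rfl, rfl⟩))
  have hel : K.IsLink e x w := (hl _ _ _).2 (Or.inr (Or.inl ⟨rfl, rfl⟩))
  obtain rfl : f' = f := by
    have := hfl.edge_mem
    rw [hKE] at this
    exact (this.resolve_right hf).symm
  have hGK : G.edgeSet ⊆ K.edgeSet := hKE ▸ Set.subset_insert _ _
  have hVGK : G.vertexSet ⊆ K.vertexSet := hV ▸ Set.subset_insert _ _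
  refine ⟨{
    edgeEmb := ⟨⟨Set.inclusion hGK, Set.inclusion_injective hGK⟩, Iff.rfl⟩
    vertexEmb := ⟨Set.inclusion hVGK, Set.inclusion_injective hVGK⟩
    e := ⟨e, hxy.edge_mem⟩
    f := ⟨f', hfl.edge_mem⟩
    x := ⟨x, hxy.left_mem⟩
    y := ⟨y, hxy.right_mem⟩
    w := ⟨w, hel.right_mem⟩
    exists_edgeEmb := ?_
    edgeEmb_ne := ?_
    exists_vertexEmb := ?_
    vertexEmb_ne := ?_
    isLink_of_ne := ?_
    isLink_e := hxy
    isLink_edgeEmb_e := hel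
    isLink_f := hfl }⟩
  · rintro ⟨g, hg⟩ hgf
    have hg' : g ∈ insert f' G.edgeSet := hKE ▸ hg
    exact ⟨⟨g, hg'.resolve_left fun h => hgf (Subtype.ext h)⟩, rfl⟩
  · rintro ⟨g, hg⟩ h
    have hgf : g = f' := congrArg (fun z : K.edgeSet => z.1) h
    exact hf' (hgf ▸ hg)
  · rintro ⟨v, hv⟩ hvw
    have hv' : v ∈ insert w G.vertexSet := hV ▸ hv
    exact ⟨⟨v, hv'.resolve_left fun h => hvw (Subtype.ext h)⟩, rfl⟩
  · rintro ⟨v, hv⟩ h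
    have hvw : v = w := congrArg (fun z : K.vertexSet => z.1) h
    exact hw (hvw ▸ hv)
  · rintro ⟨g, hg⟩ hge u v huv
    exact (hl _ _ _).2 (Or.inl ⟨fun h => hge (Subtype.ext h), huv⟩)

end

/-! ### Polygons as iterated subdivisions, and acyclicity of paths in positive degrees. -/

section Polygon

theorem mem_edgeSet_polygon {n : ℕ} (i : Fin n) : i ∈ (polygon n).edgeSet :=
  ⟨i, finRotate n i, rfl⟩

theorem mem_vertexSet_polygon {n : ℕ} (i : Fin n) : i ∈ (polygon n).vertexSet := trivial

theorem isLink_polygon {n : ℕ} {i x y : Fin n} :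
    (polygon n).IsLink i x y ↔ s(x, y) = s(i, finRotate n i) := Iff.rfl

/-- The polygon with `m + 2` edges is a subdivision of the polygon with `m + 1` edges. -/
def polygonSubdivisionData (m : ℕ) : SubdivisionData (polygon (m + 1)) (polygon (m + 2)) where
  edgeEmb := ⟨⟨fun g => ⟨Fin.castSucc g.1, mem_edgeSet_polygon _⟩, fun a b h => by
    have h' := congrArg (fun z : (polygon (m + 2)).edgeSet => z.1) h
    exact Subtype.ext (Fin.castSucc_injective _ h')⟩, Iff.rfl⟩
  vertexEmb := ⟨fun v => ⟨Fin.castSucc v.1, mem_vertexSet_polygon _⟩, fun a b h => by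
    have h' := congrArg (fun z : (polygon (m + 2)).vertexSet => z.1) h
    exact Subtype.ext (Fin.castSucc_injective _ h')⟩
  e := ⟨Fin.last m, mem_edgeSet_polygon _⟩
  f := ⟨Fin.last (m + 1), mem_edgeSet_polygon _⟩
  x := ⟨Fin.last m, mem_vertexSet_polygon _⟩
  y := ⟨0, mem_vertexSet_polygon _⟩
  w := ⟨Fin.last (m + 1), mem_vertexSet_polygon _⟩
  exists_edgeEmb := by
    rintro ⟨g, hg⟩ hgf
    have hg' : g ≠ Fin.last (m + 1) := fun h => hgf (Subtype.ext h)
    exact ⟨⟨g.castPred hg', mem_edgeSet_polygon _⟩, Subtype.ext (Fin.castSucc_castPred g hg')⟩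
  edgeEmb_ne := by
    rintro ⟨g, hg⟩ h
    exact Fin.castSucc_ne_last g (congrArg (fun z : (polygon (m + 2)).edgeSet => z.1) h)
  exists_vertexEmb := by
    rintro ⟨g, hg⟩ hgf
    have hg' : g ≠ Fin.last (m + 1) := fun h => hgf (Subtype.ext h)
    exact ⟨⟨g.castPred hg', mem_vertexSet_polygon _⟩, Subtype.ext (Fin.castSucc_castPred g hg')⟩
  vertexEmb_ne := by
    rintro ⟨g, hg⟩ h
    exact Fin.castSucc_ne_last g (congrArg (fun z : (polygon (m + 2)).vertexSet => z.1) h)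
  isLink_of_ne := by
    rintro ⟨g, hg⟩ hge u v huv
    have hg' : g ≠ Fin.last m := fun h => hge (Subtype.ext h)
    have h : (finRotate (m + 2)) g.castSucc = (finRotate (m + 1) g).castSucc := by
      ext
      rw [coe_finRotate_of_ne_last (Fin.castSucc_ne_last g), Fin.val_castSucc, Fin.val_castSucc,
        coe_finRotate_of_ne_last hg']
    have := congrArg (Sym2.map Fin.castSucc) (isLink_polygon.1 huv)
    rw [Sym2.map_mk, Sym2.map_mk] at this
    exact isLink_polygon.2 (this.trans (congrArg (fun z => s(g.castSucc, z)) h.symm))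
  isLink_e := isLink_polygon.2 (by rw [finRotate_last])
  isLink_edgeEmb_e := by
    refine isLink_polygon.2 (congrArg (fun z => s(Fin.castSucc (Fin.last m), z)) (Fin.ext ?_))
    have h := coe_finRotate_of_ne_last (Fin.castSucc_ne_last (Fin.last m))
    rw [Fin.val_castSucc, Fin.val_last] at h
    exact h.symm
  isLink_f := isLink_polygon.2 (by rw [finRotate_last]; rfl)

variable (R A) in
/-- The cohomology of a path vanishes in positive degrees. -/
theorem graphDiagram_polygon_exactAt {m j k : ℕ} (hj : j ≤ m + 1) (hk : 0 < k)
    (U : Finset (polygon (m + 2)).edgeSet) (hU : ∀ g, g ∈ U ↔ g.1.val < j) :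
    (graphDiagram R A (polygon (m + 2))).ExactAt ∅ U k := by
  induction j generalizing U with
  | zero =>
    have : U = ∅ := Finset.eq_empty_of_forall_notMem fun g hg => Nat.not_lt_zero _ ((hU g).1 hg)
    exact CubeDiagram.exactAt_of_card_lt _ (by rw [this, Finset.card_empty]; exact hk)
  | succ j ih =>
    let e : (polygon (m + 2)).edgeSet := ⟨⟨j, by omega⟩, mem_edgeSet_polygon _⟩
    let x : (polygon (m + 2)).vertexSet := ⟨⟨j, by omega⟩, mem_vertexSet_polygon _⟩
    let w : (polygon (m + 2)).vertexSet := ⟨⟨j + 1, by omega⟩, mem_vertexSet_polygon _⟩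
    have hrot : ∀ i : Fin (m + 2), i.val < m + 1 → (finRotate (m + 2) i).val = i.val + 1 :=
      fun i hi => coe_finRotate_of_ne_last fun h => by
        rw [h, Fin.val_last] at hi
        omega
    -- The edges numbered below `j + 1` form a path whose last edge is pendant at vertex `j + 1`.
    refine graphDiagram_exactAt_of_pendant R A (e := e) ((hU e).2 (Nat.lt_succ_self j)) (x := x)
      (w := w) ?_ ?_ ?_ (ih (by omega) _ fun g => ?_)
    · refine isLink_polygon.2 (congrArg (fun z => s(x.1, z)) (Fin.ext ?_))
      rw [hrot _ (by simp only [e]; omega)]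
    · intro h
      have := congrArg (fun z : (polygon (m + 2)).vertexSet => z.1.val) h
      simp only [x, w] at this
      omega
    · intro g hg hge v hl
      have hgj : g.1.val < j := by
        refine lt_of_le_of_ne (Nat.lt_succ_iff.1 ((hU g).1 hg)) fun h => hge ?_
        exact Subtype.ext (Fin.ext h)
      have hr := hrot g.1 (by omega)
      rcases Sym2.eq_iff.1 (isLink_polygon.1 hl) with ⟨h, -⟩ | ⟨h, -⟩
      · have := congrArg Fin.val h
        simp only [w] at this
        omega
      · have := congrArg Fin.val h
        rw [hr] at this
        simp only [w] at this
        omega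
    · rw [Finset.mem_erase, hU]
      have : g ≠ e ↔ g.1.val ≠ j :=
        not_congr ⟨fun h => h ▸ rfl, fun h => Subtype.ext (Fin.ext h)⟩
      rw [this]
      omega

theorem hasGradedIso_polygon (𝒜 : ℕ → Submodule R A) [GradedAlgebra 𝒜] (m : ℕ) :
    HasGradedIso 𝒜 (polygon 3) 1 (polygon (m + 3)) (m + 1) := by
  induction m with
  | zero => exact HasGradedIso.refl 𝒜 _ _
  | succ m ih =>
    refine ih.trans ?_
    let S := polygonSubdivisionData (m + 2)
    have : Fintype (polygon (m + 4)).edgeSet := Fintype.ofFinite _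
    have hex : ∀ k, 0 < k →
        (graphDiagram R A (polygon (m + 4))).ExactAt ∅ (Finset.univ.erase S.f) k := by
      intro k hk
      refine graphDiagram_polygon_exactAt R A (j := m + 3) le_rfl hk _ fun g => ?_
      rw [Finset.mem_erase, and_iff_left (Finset.mem_univ g)]
      have : g ≠ S.f ↔ g.1.val ≠ m + 3 :=
        not_congr ⟨fun h => h ▸ rfl, fun h => Subtype.ext (Fin.ext h)⟩
      rw [this]
      have := g.1.isLt
      omega
    -- Exactness of the path is used in degrees `m + 2` and `m + 1`, both positive; this is why the
    -- chain starts at `polygon 3`.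
    exact (S.exists_cohomology_map_of_exactAt 𝒜 (m + 1) _ (Finset.notMem_erase _ _)
      (hex _ (Nat.succ_pos _)) fun g hg => Finset.mem_erase.2 ⟨hg, Finset.mem_univ g⟩).2
      (hex _ (Nat.succ_pos _))

end Polygon

section

variable {α β : Type*} {G : Graph α β} {n : ℕ}

/-- Supplies the side conditions of the induction at intermediate graphs: finiteness, a second edge
besides the subdivided one, and at least two vertices. -/
theorem IsSeriesParallel.finite_and_nontrivial (hn : 2 ≤ n) (h : IsSeriesParallel n G) :
    (G.vertexSet.Finite ∧ G.edgeSet.Finite) ∧ G.vertexSet.Nontrivial ∧ G.edgeSet.Nontrivial := by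
  induction h with
  | polygon G h =>
    obtain ⟨φ, ψ, -⟩ := h
    have : Nontrivial (Fin n) := Fin.nontrivial_iff_two_le.2 hn
    obtain ⟨a, b, hab⟩ := exists_pair_ne (Fin n)
    have : Nontrivial (GraphCohomology.polygon n).vertexSet :=
      ⟨⟨a, mem_vertexSet_polygon a⟩, ⟨b, mem_vertexSet_polygon b⟩,
        fun h => hab (congrArg (fun z : (GraphCohomology.polygon n).vertexSet => z.1) h)⟩
    have : Nontrivial (GraphCohomology.polygon n).edgeSet :=
      ⟨⟨a, mem_edgeSet_polygon a⟩, ⟨b, mem_edgeSet_polygon b⟩,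
        fun h => hab (congrArg (fun z : (GraphCohomology.polygon n).edgeSet => z.1) h)⟩
    exact ⟨⟨Finite.of_equiv _ φ, Finite.of_equiv _ ψ⟩,
      Set.nontrivial_coe_sort.1 φ.symm.nontrivial, Set.nontrivial_coe_sort.1 ψ.symm.nontrivial⟩
  | doubling G K _ h ih =>
    obtain ⟨f, -, hE⟩ := h.edgeSet_eq
    obtain ⟨-, -, -, -, hV, -⟩ := h
    rw [hE, hV]
    exact ⟨⟨ih.1.1, ih.1.2.insert f⟩, ih.2.1, ih.2.2.mono (Set.subset_insert _ _)⟩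
  | subdivision G K _ h ih =>
    obtain ⟨f, -, hE⟩ := h.edgeSet_eq
    obtain ⟨-, -, -, -, -, -, w, -, hV, -⟩ := h
    rw [hE, hV]
    exact ⟨⟨ih.1.1.insert w, ih.1.2.insert f⟩, ih.2.1.mono (Set.subset_insert _ _),
      ih.2.2.mono (Set.subset_insert _ _)⟩

theorem IsSeriesParallel.hasGradedEpi [LinearOrder β] (𝒜 : ℕ → Submodule R A) [GradedAlgebra 𝒜]
    (hn : 2 ≤ n) (h : IsSeriesParallel n G) [Finite G.vertexSet] :
    HasGradedEpi 𝒜 (GraphCohomology.polygon n) (n - 2) G (G.vertexSet.ncard - 2) := by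
  rename_i hfin
  revert hfin
  induction h with
  | polygon G h =>
    intro _
    have hcard : G.vertexSet.ncard = n := by
      obtain ⟨φ, -, -⟩ := h
      rw [← Nat.card_coe_set_eq, ← Nat.card_congr φ]
      change Nat.card (Set.univ : Set (Fin n)) = n
      simp
    rw [hcard]
    exact (h.hasGradedIso 𝒜 _).hasGradedEpi
  | doubling G K hG h ih =>
    intro _
    have hfin := (hG.finite_and_nontrivial hn).1
    have : Finite G.vertexSet := hfin.1
    have : Finite K.edgeSet := ((hG.doubling G K h).finite_and_nontrivial hn).1.2
    have hV : K.vertexSet = G.vertexSet := by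
      obtain ⟨-, -, -, -, hV, -⟩ := h
      exact hV
    rw [hV]
    exact ih.trans (h.hasGradedIso 𝒜 _).hasGradedEpi
  | subdivision G K hG h ih =>
    intro _
    obtain ⟨⟨hfin, -⟩, hVn, hEn⟩ := hG.finite_and_nontrivial hn
    have : Finite G.vertexSet := hfin
    have : Finite K.edgeSet := ((hG.subdivision G K h).finite_and_nontrivial hn).1.2
    obtain ⟨S⟩ := h.nonempty_subdivisionData
    have h2 : 1 < G.vertexSet.ncard := Set.one_lt_ncard_iff_nontrivial.2 hVn
    have hcard := S.card_vertexSet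
    rw [Nat.card_coe_set_eq, Nat.card_coe_set_eq] at hcard
    -- At least two vertices in `G` are needed for the truncated subtraction to commute with adding
    -- one.
    rw [show K.vertexSet.ncard - 2 = G.vertexSet.ncard - 2 + 1 by omega]
    refine ih.trans (S.hasGradedEpi 𝒜 ?_ (by rw [Nat.card_coe_set_eq]; omega))
    have := Set.nontrivial_coe_sort.2 hEn
    exact exists_ne S.e

end

end SeriesParallel

end

end GraphCohomology

theorem mainTheorem12 {A : Type*} [CommRing A] (𝒜 : ℕ → Submodule ℤ A) [GradedAlgebra 𝒜]
    [∀ i, Module.Free ℤ (𝒜 i)] [∀ i, Module.Finite ℤ (𝒜 i)]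
    (n : ℕ) (hn : 2 ≤ n)
    {α β : Type*} [LinearOrder β] (G : Graph α β) [Finite G.vertexSet]
    (hG : GraphCohomology.IsSeriesParallel n G) :
    (∃ f : GraphCohomology.Cohomology ℤ A (GraphCohomology.polygon n) (n - 2) →ₗ[ℤ]
          GraphCohomology.Cohomology ℤ A G (G.vertexSet.ncard - 2),
        Function.Surjective f ∧
        ∀ j, (GraphCohomology.cohomologyDegree (GraphCohomology.polygon n) 𝒜 (n - 2) j).map f =
          GraphCohomology.cohomologyDegree G 𝒜 (G.vertexSet.ncard - 2) j) ∧
    (3 ≤ n →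
      (∃ φ : GraphCohomology.Cohomology ℤ A (GraphCohomology.polygon 3) 1 ≃ₗ[ℤ]
            GraphCohomology.Cohomology ℤ A (GraphCohomology.polygon n) (n - 2),
          ∀ j, (GraphCohomology.cohomologyDegree (GraphCohomology.polygon 3) 𝒜 1 j).map
              φ.toLinearMap =
            GraphCohomology.cohomologyDegree (GraphCohomology.polygon n) 𝒜 (n - 2) j) ∧
      (∃ g : GraphCohomology.Cohomology ℤ A (GraphCohomology.polygon 3) 1 →ₗ[ℤ]
            GraphCohomology.Cohomology ℤ A G (G.vertexSet.ncard - 2),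
          Function.Surjective g ∧
          ∀ j, (GraphCohomology.cohomologyDegree (GraphCohomology.polygon 3) 𝒜 1 j).map g =
            GraphCohomology.cohomologyDegree G 𝒜 (G.vertexSet.ncard - 2) j)) := by
  have hepi := hG.hasGradedEpi 𝒜 hn
  refine ⟨hepi, fun hn3 => ?_⟩
  have hiso : GraphCohomology.HasGradedIso 𝒜 (GraphCohomology.polygon 3) 1
      (GraphCohomology.polygon n) (n - 2) := by
    obtain ⟨m, rfl⟩ := Nat.exists_eq_add_of_le' hn3
    exact GraphCohomology.hasGradedIso_polygon 𝒜 m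
  exact ⟨hiso, hiso.hasGradedEpi.trans hepi⟩
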